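/- Let $n\ge 2$. Let $K_n^D$ be the complete signed graph on the vertices $1,\dots,n$, with one negative edge $(i,j,-)$ and one positive edge $(i,j,+)$ for every $1\le i<j\le n$. To the edge $(i,j,\pm)$ attach the vector $\mathbf e_i\pm\mathbf e_j\in\mathbb Z^n$, and let $M$ be the $n\times n(n-1)$ matrix whose columns are these vectors. Let $$CRYD_n=\mathcal F_{K_n^D}(2,0,\dots,0)=\{\,b\in\mathbb R_{\ge 0}^{\,n(n-1)} : M b=(2,0,\dots,0)^{T}\,\}$$ be the corresponding flow polytope. Let $\mathrm{vol}(CRYD_n)$ be its normalized volume: if $d$ is the dimension of the polytope, this is $d!$ times its $d$-dimensional volume in its affine span, where volume is scaled so that a fundamental parallelepiped of the lattice of integer vectors parallel to the affine span has volume $1$. Then $$\mathrm{vol}(CRYD_n)=CT_{x_{n-2}}\cdots CT_{x_2}CT_{x_1}\ \prod_{i=1}^{n-2}x_i^{-1}(1-x_i)^{-2}\prod_{1\le i<j\le n-2}(x_j-x_i)^{-1}(1-x_j-x_i)^{-1},$$ where $CT_{x_i}$ denotes the constant term in the Laurent expansion in the variable $x_i$ (about $x_i=0$); the constant terms are taken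 successively, first in $x_1$ (the coefficients being functions of $x_2,\dots,x_{n-2}$), then in $x_2$, and so on. Equivalently, the product is expanded in the field of iterated Laurent series $\mathbb Q((x_{n-2}))\cdots((x_2))((x_1))$. For $n=2$ the right-hand side is $1$. -/

import Mathlib

open MeasureTheory

noncomputable section

/-! ### Signed graphs and flow polytopes -/

/-- A (finite) signed graph on the vertex set `Fin n`, with loops and multiple edges allowed.
An edge `e` joins `left e ≤ right e` and carries the sign `sign e = ±1`; loops are positive. -/
structure SignedGraph (n : ℕ) where
  Edge : Type
  [fintypeEdge : Fintype Edge]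
  left : Edge → Fin n
  right : Edge → Fin n
  left_le_right : ∀ e, left e ≤ right e
  sign : Edge → ℤˣ
  sign_loop : ∀ e, left e = right e → sign e = 1

attribute [instance] SignedGraph.fintypeEdge

namespace SignedGraph

variable {n : ℕ}

/-- The positive type `C` root attached to an edge: `e_i - e_j` for a negative edge `(i, j, -)`,
and `e_i + e_j` for a positive edge `(i, j, +)` (so `2 e_i` for a loop at `i`). -/
def root (G : SignedGraph n) (e : G.Edge) : Fin n → ℤ :=
  Pi.single (G.left e) 1 + ((G.sign e : ℤˣ) : ℤ) • Pi.single (G.right e) 1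

/-- The matrix whose columns are the roots of the edges. -/
def rootMatrix (G : SignedGraph n) : Matrix (Fin n) G.Edge ℝ :=
  Matrix.of fun v e => (G.root e v : ℝ)

/-- The flow polytope with netflow `a`: all nonnegative real edge flows `b` with `M_G b = a`. -/
def flowPolytope (G : SignedGraph n) (a : Fin n → ℤ) : Set (G.Edge → ℝ) :=
  {b | (∀ e, 0 ≤ b e) ∧ G.rootMatrix.mulVec b = fun v => (a v : ℝ)}

end SignedGraph

/-- The complete signed graph of type `D_n`: one negative and one positive edge between `i` and `j`
for all `i < j`, and no loops. -/
def completeSignedGraphD (n : ℕ) : SignedGraph n where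
  Edge := {p : Fin n × Fin n // p.1 < p.2} × ℤˣ
  left e := e.1.1.1
  right e := e.1.1.2
  left_le_right e := e.1.2.le
  sign e := e.2
  sign_loop e h := absurd h e.1.2.ne

/-- The type `D_n` Chan-Robbins-Yuen polytope: the flow polytope of the complete signed graph with
netflow `(2, 0, …, 0)`. -/
def CRYD (n : ℕ) : Set ((completeSignedGraphD n).Edge → ℝ) :=
  (completeSignedGraphD n).flowPolytope fun v => if v.val = 0 then 2 else 0

/-! ### Normalized volume -/

/-- The lattice of integer points of a subspace `W` of `ℝ^ι`. -/
def integerPoints {ι : Type*} (W : Submodule ℝ (ι → ℝ)) : Submodule ℤ W where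
  carrier := {w | ∀ i, ∃ k : ℤ, (w : ι → ℝ) i = k}
  zero_mem' _ := ⟨0, by simp⟩
  add_mem' {x y} hx hy i := by
    obtain ⟨k, hk⟩ := hx i
    obtain ⟨l, hl⟩ := hy i
    exact ⟨k + l, by simp [hk, hl]⟩
  smul_mem' c x hx i := by
    obtain ⟨k, hk⟩ := hx i
    exact ⟨c * k, by simp [hk]⟩

/-- The normalized volume of a polytope `P ⊆ ℝ^ι`. Translate `P` by one of its points into the
direction `W` of its affine span. The normalized volume is `(dim W)!` times the volume of the
translate, where volume in `W` is scaled so that a fundamental parallelepiped of the lattice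
`W ∩ ℤ^ι` has volume `1`: a unimodular simplex has normalized volume `1`. (The quotient of the two
volumes does not depend on which Haar measure of `W` is used, nor on the point, and the empty set
has normalized volume `0`.) -/
def normalizedVolume {ι : Type*} [Fintype ι] (P : Set (ι → ℝ)) : ℝ :=
  open Classical in
  if h : P.Nonempty then
    (Module.finrank ℝ (vectorSpan ℝ P)).factorial *
      ((Measure.addHaar : Measure (vectorSpan ℝ P)).real
          {w : vectorSpan ℝ P | h.some + (w : ι → ℝ) ∈ P} /
        ZLattice.covolume (integerPoints (vectorSpan ℝ P)) Measure.addHaar)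
  else 0

/-- The base point in the definition of the normalized volume is irrelevant. -/
theorem normalizedVolume_eq {ι : Type*} [Fintype ι] {P : Set (ι → ℝ)} {p : ι → ℝ} (hp : p ∈ P) :
    normalizedVolume P =
      (Module.finrank ℝ (vectorSpan ℝ P)).factorial *
        ((Measure.addHaar : Measure (vectorSpan ℝ P)).real
            {w : vectorSpan ℝ P | p + (w : ι → ℝ) ∈ P} /
          ZLattice.covolume (integerPoints (vectorSpan ℝ P)) Measure.addHaar) := by
  have h : P.Nonempty := ⟨p, hp⟩
  have key : {w : vectorSpan ℝ P | h.some + (w : ι → ℝ) ∈ P} =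
      (fun w => (⟨h.some - p, vsub_mem_vectorSpan ℝ h.some_mem hp⟩ : vectorSpan ℝ P) + w) ⁻¹'
        {w : vectorSpan ℝ P | p + (w : ι → ℝ) ∈ P} := by
    ext w
    simp only [Set.mem_ofPred_eq, Set.mem_preimage, Submodule.coe_add]
    rw [show p + (h.some - p + (w : ι → ℝ)) = h.some + w by abel]
  rw [normalizedVolume, dif_pos h, key, Measure.real, Measure.real, measure_preimage_add]

/-! ### Iterated Laurent series and iterated constant terms -/

/-- The fields of iterated Laurent series over `ℚ`, bundled with their field structure:
`ℚ` for no variable, and `K((x))` after `K` when a variable `x` is added. -/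
def iterLaurentField : ℕ → (K : Type) × Field K
  | 0 => ⟨ℚ, inferInstance⟩
  | m + 1 =>
    letI := (iterLaurentField m).2
    ⟨LaurentSeries (iterLaurentField m).1, inferInstance⟩

/-- `IterLaurent m` is the field `ℚ((x_m))((x_{m-1}))⋯((x_1))`: an element is expanded as a Laurent
series in `x_1`, whose coefficients are Laurent series in `x_2`, and so on. -/
def IterLaurent (m : ℕ) : Type := (iterLaurentField m).1

instance (m : ℕ) : Field (IterLaurent m) := (iterLaurentField m).2

/-- The variables `x_1, …, x_m` (indexed by `Fin m`) of `ℚ((x_m))⋯((x_1))`: the first variable is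
the outermost one, the others come from the coefficient field. -/
def iterLaurentX : (m : ℕ) → Fin m → IterLaurent m
  | 0 => Fin.elim0
  | m + 1 => Fin.cons
      (show IterLaurent (m + 1) from (HahnSeries.single 1 1 : LaurentSeries (IterLaurent m)))
      fun i => show IterLaurent (m + 1) from
        (HahnSeries.C (iterLaurentX m i) : LaurentSeries (IterLaurent m))

/-- The constant term in the first (outermost) variable `x_1`, an iterated Laurent series in the
remaining variables. -/
def constantTerm {m : ℕ} (f : IterLaurent (m + 1)) : IterLaurent m :=
  (show LaurentSeries (IterLaurent m) from f).coeff 0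

/-- The iterated constant term `CT_{x_m} ⋯ CT_{x_2} CT_{x_1} f`. -/
def iteratedConstantTerm : (m : ℕ) → IterLaurent m → ℚ
  | 0, f => f
  | m + 1, f => iteratedConstantTerm m (constantTerm f)

/-- The rational function
`∏_i x_i⁻¹ (1 - x_i)⁻² ∏_{i < j} (x_j - x_i)⁻¹ (1 - x_j - x_i)⁻¹` evaluated in a field. -/
def morrisLikeFunction {K : Type*} [Field K] {m : ℕ} (x : Fin m → K) : K :=
  (∏ i, (x i)⁻¹ * ((1 - x i) ^ 2)⁻¹) *
    ∏ i, ∏ j ∈ Finset.Ioi i, (x j - x i)⁻¹ * (1 - x j - x i)⁻¹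

end

noncomputable section

open scoped ENNReal Nat Pointwise

/-! Write n = m + 2. Both sides equal the natural number `flowCount m (Sum.elim 0 1)`, because
removing one variable from the constant term and removing one vertex from a volume integral obey the
same recursion.

Constant term: every factor linking x_1 to a later x_j has the form 1/(q - x_1) with q = x_j or q =
1 - x_j, and expands as ∑ x_1^k / q^(k+1), while (1 - x_1)^(-(b+1)) = ∑ C(b+k, b) x_1^k. Taking the
constant term distributes the exponent of x_1⁻¹ over these factors and raises the exponents of the
remaining x_j and 1 - x_j (`coeff_zero_morrisLikeWeight`).

Volume: adding all conservation equations shows that the positive edges carry total flow 1, so the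
polytope is a slice of a cone of flows. The integral of exp(-positive flow) over the cone is d!
times the volume of the slice (`lintegral_exp_neg_cone`), and under this weight the edges become
independent: Lebesgue for negative edges, exponential for positive ones. The negative edges at the
first vertex act as slack variables and turn the equations at the other vertices into inequalities t
≤ s + ∑ c_i, where t and s are the negative and positive inflows recorded so far and the c_i are the
flows on the outgoing edges.

If t has density t^a/a!, integrating it out gives (s + ∑ c_i)^(a+1)/(a+1)!, and the multinomial
theorem distributes a + 1 over s and the outgoing edges. The power of s integrates to a binomial
coefficient; the power of c_i changes the density on that edge, which is then convolved with the
inflow at its other end. This is the recursion of `flowCount` (`lintegral_flowVolume`). The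
inequality at the second vertex is vacuous, which leaves n - 2 variables and the starting exponents
1 and 2. -/

/-- The iterated constant term of a Morris-type product with exponents given by `κ`, by recursion on
the number of variables: the expansion in the first variable distributes its exponent over the
factors. It is also a weighted count of integer flows. -/
def flowCount : (m : ℕ) → (Fin m ⊕ Fin m → ℕ) → ℕ
  | 0, _ => 1
  | m + 1, κ => ∑ k ∈ Finset.piAntidiag (Finset.univ : Finset (Option (Fin m ⊕ Fin m)))
        (κ (Sum.inl 0) + 1),
      (κ (Sum.inr 0) + k none).choose (κ (Sum.inr 0)) *
        flowCount m fun i => κ (i.map Fin.succ Fin.succ) + k (some i) + 1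

/-! ### Constant terms: expansion in one variable -/

theorem PowerSeries.coeff_prod_univ_eq_sum_piAntidiag {R ι : Type*} [CommSemiring R] [Fintype ι]
    [DecidableEq ι] (f : ι → PowerSeries R) (d : ℕ) :
    PowerSeries.coeff d (∏ j, f j) =
      ∑ l ∈ Finset.piAntidiag Finset.univ d, ∏ i, PowerSeries.coeff (l i) (f i) := by
  rw [PowerSeries.coeff_prod]
  refine Finset.sum_bij (fun l _ => (l : ι → ℕ)) ?_ ?_ ?_ ?_
  · intro l hl
    rw [Finset.mem_finsuppAntidiag'] at hl
    simp [← hl.1, Finsupp.sum_fintype]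
  · intro _ _ _ _ h
    exact DFunLike.coe_injective h
  · intro l hl
    refine ⟨Finsupp.equivFunOnFinite.symm l, ?_, rfl⟩
    simp only [Finset.mem_piAntidiag] at hl
    simp [Finset.mem_finsuppAntidiag, ← hl.1]
  · intros; rfl

namespace LaurentSeries

variable {K : Type*} [Field K]

/-- Geometric series in x/q. The scalar q is invertible in the coefficient field, so this is where
the order of the iterated expansion enters. -/
theorem C_sub_X_inv {q : K} (hq : q ≠ 0) :
    (HahnSeries.C q - HahnSeries.single 1 1 : LaurentSeries K)⁻¹ =
      HahnSeries.ofPowerSeries ℤ K (PowerSeries.mk fun k => (q ^ (k + 1))⁻¹) := by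
  refine (eq_inv_of_mul_eq_one_left ?_).symm
  rw [← HahnSeries.ofPowerSeries_X, ← HahnSeries.ofPowerSeries_C, ← map_sub, ← map_mul,
    ← map_one (HahnSeries.ofPowerSeries ℤ K)]
  congr 1
  ext k
  rw [mul_sub, map_sub, mul_comm _ (PowerSeries.C q), PowerSeries.coeff_C_mul]
  cases k with
  | zero => simp [hq]
  | succ k =>
    rw [PowerSeries.coeff_succ_mul_X]
    simp only [PowerSeries.coeff_mk, PowerSeries.coeff_one]
    field_simp
    simp [pow_succ']

theorem one_sub_X_pow_inv (b : ℕ) :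
    ((1 - HahnSeries.single 1 1 : LaurentSeries K) ^ (b + 1))⁻¹ =
      HahnSeries.ofPowerSeries ℤ K (PowerSeries.mk fun k => ((b + k).choose b : K)) := by
  refine (eq_inv_of_mul_eq_one_left ?_).symm
  rw [← PowerSeries.mk_one_pow_eq_mk_choose_add, ← HahnSeries.ofPowerSeries_X,
    ← map_one (HahnSeries.ofPowerSeries ℤ K), ← map_sub, ← map_pow, ← map_mul, ← mul_pow,
    PowerSeries.mk_one_mul_one_sub_eq_one, one_pow]

/-- Apart from x^(-a) everything is a power series, so its coefficient of x^a is needed. The index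
`none` stands for the factor 1 - x, and `some i` for q_i - x. -/
theorem coeff_zero_mul_prod {ι : Type*} [Fintype ι] [DecidableEq ι] (a b : ℕ) {q : ι → K}
    (hq : ∀ i, q i ≠ 0) (r : K) :
    HahnSeries.coeff (((HahnSeries.single 1 1 : LaurentSeries K) ^ a)⁻¹ *
      ((1 - HahnSeries.single 1 1 : LaurentSeries K) ^ (b + 1))⁻¹ *
      (∏ i, (HahnSeries.C (q i) - HahnSeries.single 1 1 : LaurentSeries K)⁻¹) *
      HahnSeries.C r) 0 =
    ∑ k ∈ Finset.piAntidiag (Finset.univ : Finset (Option ι)) a,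
      ((b + k none).choose b : K) * ((∏ i, (q i ^ (k (some i) + 1))⁻¹) * r) := by
  have h1 : ((HahnSeries.single 1 1 : LaurentSeries K) ^ a)⁻¹ = HahnSeries.single (-(a : ℤ)) 1 := by
    refine (eq_inv_of_mul_eq_one_left ?_).symm
    rw [HahnSeries.single_pow, HahnSeries.single_mul_single]
    simp
  let f : Option ι → PowerSeries K := fun o => o.elim
    (PowerSeries.mk fun k => ((b + k).choose b : K))
    fun i => PowerSeries.mk fun k => ((q i) ^ (k + 1))⁻¹
  have h2 : ((1 - HahnSeries.single 1 1 : LaurentSeries K) ^ (b + 1))⁻¹ *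
      (∏ i, (HahnSeries.C (q i) - HahnSeries.single 1 1 : LaurentSeries K)⁻¹) =
      HahnSeries.ofPowerSeries ℤ K (∏ o, f o) := by
    rw [Fintype.prod_option, map_mul, map_prod, one_sub_X_pow_inv]
    congr 1
    exact Finset.prod_congr rfl fun i _ => C_sub_X_inv (hq i)
  rw [mul_assoc, mul_assoc, ← mul_assoc _ _ (HahnSeries.C r), h1, h2, ← HahnSeries.ofPowerSeries_C,
    ← map_mul, HahnSeries.coeff_single_mul, zero_sub, neg_neg,
    HahnSeries.ofPowerSeries_apply_coeff, PowerSeries.coeff_mul_C, one_mul,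
    PowerSeries.coeff_prod_univ_eq_sum_piAntidiag, Finset.sum_mul]
  refine Finset.sum_congr rfl fun k _ => ?_
  rw [Fintype.prod_option, mul_assoc]
  simp [f]

end LaurentSeries

/-- `morrisLikeFunction` with arbitrary exponents of the factors in one variable. -/
def morrisLikeWeight {K : Type*} [Field K] {m : ℕ} (κ : Fin m ⊕ Fin m → ℕ) (x : Fin m → K) : K :=
  (∏ i, ((x i) ^ (κ (.inl i) + 1))⁻¹ * ((1 - x i) ^ (κ (.inr i) + 1))⁻¹) *
    ∏ i, ∏ j ∈ Finset.Ioi i, (x j - x i)⁻¹ * (1 - x j - x i)⁻¹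

theorem map_morrisLikeWeight {K L : Type*} [Field K] [Field L] (f : K →+* L) {m : ℕ}
    (κ : Fin m ⊕ Fin m → ℕ) (x : Fin m → K) :
    f (morrisLikeWeight κ x) = morrisLikeWeight κ fun i => f (x i) := by
  simp [morrisLikeWeight, map_prod]

theorem coeff_zero_morrisLikeWeight {K : Type*} [Field K] {m : ℕ}
    (κ : Fin (m + 1) ⊕ Fin (m + 1) → ℕ) {x : Fin m → K} (h0 : ∀ i, x i ≠ 0) (h1 : ∀ i, x i ≠ 1) :
    HahnSeries.coeff (morrisLikeWeight κ
      (Fin.cons (HahnSeries.single 1 1) fun i => HahnSeries.C (x i) :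
        Fin (m + 1) → LaurentSeries K)) 0 =
    ∑ k ∈ Finset.piAntidiag (Finset.univ : Finset (Option (Fin m ⊕ Fin m))) (κ (.inl 0) + 1),
      ((κ (.inr 0) + k none).choose (κ (.inr 0)) : K) *
        morrisLikeWeight (fun i => κ (i.map Fin.succ Fin.succ) + k (some i) + 1) x := by
  -- Both x_j - x_1 and 1 - x_j - x_1 have the form q - x_1; the hypotheses `h0` and `h1` make each
  -- q nonzero.
  have key := LaurentSeries.coeff_zero_mul_prod (κ (.inl 0) + 1) (κ (.inr 0))
    (q := Sum.elim x fun i => 1 - x i)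
    (by rintro (i | i); exacts [h0 i, sub_ne_zero.2 (h1 i).symm])
    (morrisLikeWeight (fun i => κ (i.map Fin.succ Fin.succ)) x)
  convert key using 1
  · congr 1
    rw [map_morrisLikeWeight]
    simp only [morrisLikeWeight, Fin.prod_univ_succ, Fin.prod_Ioi_zero, Fin.prod_Ioi_succ,
      Fin.cons_zero, Fin.cons_succ, Fintype.prod_sum_type, Sum.elim_inl, Sum.elim_inr,
      Finset.prod_mul_distrib, map_sub, map_one, Sum.map_inl, Sum.map_inr]
    ring
  · refine Finset.sum_congr rfl fun k _ => ?_
    congr 1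
    rw [morrisLikeWeight, morrisLikeWeight, ← mul_assoc]
    congr 1
    rw [Fintype.prod_sum_type, ← Finset.prod_mul_distrib, ← Finset.prod_mul_distrib]
    refine Finset.prod_congr rfl fun i _ => ?_
    simp only [Sum.elim_inl, Sum.elim_inr, Sum.map_inl, Sum.map_inr, ← mul_inv]
    congr 1
    ring

theorem iterLaurentX_ne_zero {m : ℕ} (i : Fin m) : iterLaurentX m i ≠ 0 := by
  induction m with
  | zero => exact i.elim0
  | succ m ih =>
    refine Fin.cases ?_ (fun i => ?_) i
    · exact (HahnSeries.single_ne_zero one_ne_zero :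
        (HahnSeries.single 1 1 : LaurentSeries (IterLaurent m)) ≠ 0)
    · exact (HahnSeries.C_ne_zero (ih i) :
        (HahnSeries.C (iterLaurentX m i) : LaurentSeries (IterLaurent m)) ≠ 0)

theorem iterLaurentX_ne_one {m : ℕ} (i : Fin m) : iterLaurentX m i ≠ 1 := by
  induction m with
  | zero => exact i.elim0
  | succ m ih =>
    refine Fin.cases ?_ (fun i => ?_) i
    · intro h
      have := congrArg (fun f : LaurentSeries (IterLaurent m) => f.coeff 0) h
      change (HahnSeries.single (1 : ℤ) (1 : IterLaurent m)).coeff 0 =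
        (1 : LaurentSeries (IterLaurent m)).coeff 0 at this
      simp at this
    · intro h
      exact ih i (HahnSeries.C_injective (Γ := ℤ)
        (h.trans (map_one (HahnSeries.C (Γ := ℤ) (R := IterLaurent m))).symm))

/-- The iterated constant term as an additive map. -/
def iteratedConstantTermHom : (m : ℕ) → IterLaurent m →+ ℚ
  | 0 => AddMonoidHom.id ℚ
  | m + 1 => (iteratedConstantTermHom m).comp
      (HahnSeries.coeff.addMonoidHom (Γ := ℤ) (R := IterLaurent m) 0)

theorem iteratedConstantTermHom_apply {m : ℕ} (f : IterLaurent m) :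
    iteratedConstantTermHom m f = iteratedConstantTerm m f := by
  induction m with
  | zero => rfl
  | succ m ih => exact ih (constantTerm f)

theorem iteratedConstantTerm_morrisLikeWeight {m : ℕ} (κ : Fin m ⊕ Fin m → ℕ) :
    iteratedConstantTerm m (morrisLikeWeight κ (iterLaurentX m)) = flowCount m κ := by
  induction m with
  | zero =>
    have : morrisLikeWeight κ (iterLaurentX 0) = 1 := by simp [morrisLikeWeight]
    rw [this, flowCount, Nat.cast_one]
    rfl
  | succ m ih =>
    have h := coeff_zero_morrisLikeWeight κ (x := iterLaurentX m)
      iterLaurentX_ne_zero iterLaurentX_ne_one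
    have h' : constantTerm (morrisLikeWeight κ (iterLaurentX (m + 1))) = _ := h
    rw [iteratedConstantTerm, h', ← iteratedConstantTermHom_apply, map_sum, flowCount,
      Nat.cast_sum]
    refine Finset.sum_congr rfl fun k _ => ?_
    -- The binomial weight is a natural number, so additivity suffices to pull it out.
    rw [← nsmul_eq_mul, map_nsmul, iteratedConstantTermHom_apply, ih, nsmul_eq_mul, Nat.cast_mul]

/-- The exponents 1 of x_i⁻¹ and 2 of (1 - x_i)⁻¹ are recorded as 0 and 1, since `κ` stores
exponents minus one. -/
theorem iteratedConstantTerm_morrisLikeFunction (m : ℕ) :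
    iteratedConstantTerm m (morrisLikeFunction (iterLaurentX m)) =
      flowCount m (Sum.elim 0 1) := by
  rw [← iteratedConstantTerm_morrisLikeWeight]
  congr 1
  simp [morrisLikeFunction, morrisLikeWeight]

/-! ### Integration over finite products of measures on the line -/

namespace MeasureTheory

section Pi

variable {ι ι' : Type*} [Fintype ι] [Fintype ι']

theorem measurePreserving_pi_option (μ : Option ι → Measure ℝ) [∀ i, SigmaFinite (μ i)] :
    MeasurePreserving (fun p : ℝ × (ι → ℝ) => fun o : Option ι => o.elim p.1 p.2)
      ((μ none).prod (Measure.pi fun i => μ (some i))) (Measure.pi μ) := by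
  have hm : Measurable (fun p : ℝ × (ι → ℝ) => fun o : Option ι => o.elim p.1 p.2) := by
    refine measurable_pi_iff.2 fun o => ?_
    cases o with
    | none => exact measurable_fst
    | some i => exact (measurable_pi_apply i).comp measurable_snd
  refine ⟨hm, (Measure.pi_eq fun s hs => ?_).symm⟩
  rw [Measure.map_apply hm (MeasurableSet.univ_pi hs), Fintype.prod_option, ← Measure.pi_pi,
    ← Measure.prod_prod]
  congr 1
  ext p
  simp [Set.mem_pi, Option.forall]

theorem lintegral_pi_option (μ : Option ι → Measure ℝ) [∀ i, SigmaFinite (μ i)]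
    {f : (Option ι → ℝ) → ℝ≥0∞} (hf : Measurable f) :
    ∫⁻ x, f x ∂Measure.pi μ =
      ∫⁻ t, ∫⁻ y, f (fun o => o.elim t y) ∂(Measure.pi fun i => μ (some i)) ∂μ none := by
  rw [← (measurePreserving_pi_option μ).lintegral_comp hf]
  exact lintegral_prod _ (hf.comp (measurePreserving_pi_option μ).measurable).aemeasurable

theorem lintegral_pi_equiv (e : ι ≃ ι') (μ : ι' → Measure ℝ) [∀ i, SigmaFinite (μ i)]
    (f : (ι' → ℝ) → ℝ≥0∞) :
    ∫⁻ x, f x ∂Measure.pi μ =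
      ∫⁻ x, f (x ∘ e.symm) ∂(Measure.pi fun i => μ (e i)) := by
  have := measurePreserving_piCongrLeft (α := fun _ => ℝ) μ e
  rw [← this.lintegral_comp_emb (MeasurableEquiv.measurableEmbedding _)]
  refine lintegral_congr fun x => congrArg f ?_
  funext j
  obtain ⟨i, rfl⟩ := e.surjective j
  simp [MeasurableEquiv.coe_piCongrLeft, Equiv.piCongrLeft_apply_apply]

theorem lintegral_pi_sum (μ : ι ⊕ ι' → Measure ℝ) [∀ i, SigmaFinite (μ i)]
    {f : (ι ⊕ ι' → ℝ) → ℝ≥0∞} (hf : Measurable f) :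
    ∫⁻ x, f x ∂Measure.pi μ =
      ∫⁻ y, ∫⁻ z, f (Sum.elim y z) ∂(Measure.pi fun i => μ (.inr i))
        ∂(Measure.pi fun i => μ (.inl i)) := by
  have h := measurePreserving_sumPiEquivProdPi_symm (X := fun _ => ℝ) μ
  have h2 : ∀ p : (ι → ℝ) × (ι' → ℝ),
      (MeasurableEquiv.sumPiEquivProdPi fun _ => ℝ).symm p = Sum.elim p.1 p.2 := by
    intro p; funext i; cases i <;> rfl
  rw [← h.lintegral_comp hf]
  refine (lintegral_prod _ (hf.comp h.measurable).aemeasurable).trans ?_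
  simp only [Function.comp_apply, h2]

/-- Regrouping a pair of vectors as a vector of pairs turns the convolution of product measures into
the product of convolutions. -/
theorem lintegral_pi_add (μ ν : ι → Measure ℝ) [∀ i, SigmaFinite (μ i)] [∀ i, SigmaFinite (ν i)]
    [∀ i, SigmaFinite (Measure.conv (μ i) (ν i))] {f : (ι → ℝ) → ℝ≥0∞} (hf : Measurable f) :
    ∫⁻ x, ∫⁻ y, f (x + y) ∂Measure.pi ν ∂Measure.pi μ =
      ∫⁻ x, f x ∂Measure.pi fun i => Measure.conv (μ i) (ν i) := by
  have h := measurePreserving_arrowProdEquivProdArrow ℝ ℝ ι μ ν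
  have hadd : Measurable fun p : ℝ × ℝ => p.1 + p.2 := measurable_add
  have : ∀ i, SigmaFinite (((μ i).prod (ν i)).map fun p : ℝ × ℝ => p.1 + p.2) :=
    fun i => inferInstanceAs (SigmaFinite (Measure.conv (μ i) (ν i)))
  have hpi : Measure.pi (fun i => Measure.conv (μ i) (ν i)) = _ :=
    (Measure.pi_map_pi (μ := fun i => (μ i).prod (ν i)) (f := fun _ p => p.1 + p.2)
      fun i => hadd.aemeasurable).symm
  have hm : Measurable fun (x : ι → ℝ × ℝ) (i : ι) => (x i).1 + (x i).2 :=
    measurable_pi_iff.2 fun i => hadd.comp (measurable_pi_apply i)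
  have hf2 : Measurable fun p : (ι → ℝ) × (ι → ℝ) => f (p.1 + p.2) := hf.comp measurable_add
  rw [hpi, lintegral_map hf hm, ← lintegral_prod (f := fun p => f (p.1 + p.2)) hf2.aemeasurable,
    ← h.lintegral_comp hf2]
  rfl

theorem lintegral_pi_prod_mul (μ : ι → Measure ℝ) [∀ i, SigmaFinite (μ i)] {g : ι → ℝ → ℝ≥0∞}
    (hg : ∀ i, Measurable (g i)) [∀ i, SigmaFinite ((μ i).withDensity (g i))]
    {f : (ι → ℝ) → ℝ≥0∞} (hf : Measurable f) :
    ∫⁻ x, (∏ i, g i (x i)) * f x ∂Measure.pi μ =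
      ∫⁻ x, f x ∂Measure.pi fun i => (μ i).withDensity (g i) := by
  classical
  revert μ g f
  refine Fintype.induction_empty_option (P := fun ι _ => ∀ (μ : ι → Measure ℝ)
    [∀ i, SigmaFinite (μ i)] {g : ι → ℝ → ℝ≥0∞} (_ : ∀ i, Measurable (g i))
    [∀ i, SigmaFinite ((μ i).withDensity (g i))] {f : (ι → ℝ) → ℝ≥0∞} (_ : Measurable f),
    ∫⁻ x, (∏ i, g i (x i)) * f x ∂Measure.pi μ =
      ∫⁻ x, f x ∂Measure.pi fun i => (μ i).withDensity (g i)) ?_ ?_ ?_ ι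
  · intro α β _ e ih μ _ g hg _ f hf
    let _ := Fintype.ofEquiv β e.symm
    rw [lintegral_pi_equiv e, lintegral_pi_equiv e]
    refine Eq.trans ?_ (ih (fun i => μ (e i)) (fun i => hg (e i))
      (f := fun x => f (x ∘ e.symm))
      (hf.comp (measurable_pi_iff.2 fun i => measurable_pi_apply _)))
    refine lintegral_congr fun x => ?_
    rw [← e.prod_comp]
    simp
  · intro μ _ g hg _ f hf
    simp only [Finset.univ_eq_empty, Finset.prod_empty, one_mul]
    congr 2
    funext i
    exact i.elim
  · intro α _ ih μ _ g hg _ f hf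
    have hf' : ∀ t : ℝ, Measurable fun y : α → ℝ => f fun o => o.elim t y := fun t =>
      hf.comp ((measurePreserving_pi_option μ).measurable.comp measurable_prodMk_left)
    have hf2 : Measurable fun t : ℝ => ∫⁻ y, f (fun o => o.elim t y)
        ∂(Measure.pi fun i : α => (μ (some i)).withDensity (g (some i))) :=
      (hf.comp (measurePreserving_pi_option μ).measurable).lintegral_prod_right'
    have hm : Measurable fun x : Option α → ℝ => (∏ i, g i (x i)) * f x :=
      (Finset.measurable_prod _ fun i _ => (hg i).comp (measurable_pi_apply i)).mul hf
    rw [lintegral_pi_option _ hm, lintegral_pi_option _ hf,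
      lintegral_withDensity_eq_lintegral_mul _ (hg none) hf2]
    refine lintegral_congr fun t => ?_
    simp only [Fintype.prod_option, Option.elim_none, Option.elim_some, Pi.mul_apply]
    rw [← ih (fun i => μ (some i)) (fun i => hg (some i)) (hf' t),
      ← lintegral_const_mul]
    · simp only [mul_assoc]
    · exact (Finset.measurable_prod _ fun i _ =>
        (hg (some i)).comp (measurable_pi_apply i)).mul (hf' t)

end Pi

end MeasureTheory

/-! ### Erlang measures: convolution and multiplication by powers -/

/-- The measure on `ℝ` with density `t ^ k / k! * exp (-c t)` on the half line `t ≥ 0`. -/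
def erlang (c : ℝ) (k : ℕ) : Measure ℝ :=
  (volume.restrict (Set.Ici 0)).withDensity fun t =>
    ENNReal.ofReal (t ^ k / k ! * Real.exp (-(c * t)))

namespace erlang

variable (c : ℝ) (k l : ℕ)

theorem measurable_density :
    Measurable fun t : ℝ => ENNReal.ofReal (t ^ k / k ! * Real.exp (-(c * t))) := by
  fun_prop

instance : SigmaFinite (erlang c k) :=
  SigmaFinite.withDensity_of_ne_top (by simp)

theorem lintegral_eq {f : ℝ → ℝ≥0∞} (hf : Measurable f) :
    ∫⁻ t, f t ∂erlang c k =
      ∫⁻ t in Set.Ici 0, ENNReal.ofReal (t ^ k / k ! * Real.exp (-(c * t))) * f t :=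
  lintegral_withDensity_eq_lintegral_mul _ (measurable_density c k) hf

theorem ae_nonneg : ∀ᵐ t ∂erlang c k, 0 ≤ t :=
  (withDensity_absolutelyContinuous _ _).ae_le (ae_restrict_mem measurableSet_Ici)

theorem setLIntegral_Icc_pow {r : ℝ} (hr : 0 ≤ r) :
    ∫⁻ t in Set.Icc 0 r, ENNReal.ofReal (t ^ k / k !) =
      ENNReal.ofReal (r ^ (k + 1) / (k + 1)!) := by
  have hc : Continuous fun t : ℝ => t ^ k / k ! := by fun_prop
  rw [← ofReal_integral_eq_lintegral_ofReal (hc.integrableOn_Icc)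
    ((ae_restrict_mem measurableSet_Icc).mono fun t ht => by have := ht.1; positivity),
    integral_Icc_eq_integral_Ioc, ← intervalIntegral.integral_of_le hr,
    intervalIntegral.integral_div, integral_pow, Nat.factorial_succ]
  congr 1
  push_cast
  field_simp
  simp

theorem zero_apply_Iic {r : ℝ} (hr : 0 ≤ r) :
    erlang 0 k (Set.Iic r) = ENNReal.ofReal (r ^ (k + 1) / (k + 1)!) := by
  rw [← setLIntegral_Icc_pow k hr, erlang, withDensity_apply _ measurableSet_Iic,
    Measure.restrict_restrict measurableSet_Iic, Set.inter_comm, Set.Ici_inter_Iic]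
  simp

/-- With r = t + s the exponentials combine to exp(-c r), and the integral of t^k/k! over 0 ≤ t ≤ r
raises the power by one. -/
theorem conv_zero : Measure.conv (erlang c k) (erlang c 0) = erlang c (k + 1) := by
  refine Measure.ext_of_lintegral _ fun f hf => ?_
  rw [Measure.lintegral_conv hf, lintegral_eq _ _ hf,
    lintegral_eq _ _ (Measurable.lintegral_prod_right' (f := fun p : ℝ × ℝ => f (p.1 + p.2))
      (hf.comp measurable_add))]
  -- The integrand in the coordinates t and r = t + s; indicators encode 0 ≤ t ≤ r so that Tonelli
  -- applies on the whole plane.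
  set F : ℝ → ℝ → ℝ≥0∞ := fun t r => (Set.Ici 0).indicator 1 t * (Set.Ici t).indicator 1 r *
    (ENNReal.ofReal (t ^ k / k !) * ENNReal.ofReal (Real.exp (-(c * r))) * f r) with hF
  have hFm : Measurable (Function.uncurry F) := by
    have h1 : Measurable fun p : ℝ × ℝ => (Set.Ici (0 : ℝ)).indicator (1 : ℝ → ℝ≥0∞) p.1 :=
      (measurable_one.indicator measurableSet_Ici).comp measurable_fst
    have h2 : Measurable fun p : ℝ × ℝ => (Set.Ici p.1).indicator (1 : ℝ → ℝ≥0∞) p.2 := by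
      have : (fun p : ℝ × ℝ => (Set.Ici p.1).indicator (1 : ℝ → ℝ≥0∞) p.2) =
          {p : ℝ × ℝ | p.1 ≤ p.2}.indicator 1 := by
        ext p; simp [Set.indicator]
      rw [this]
      exact measurable_one.indicator (measurableSet_le measurable_fst measurable_snd)
    have h3 : Measurable fun p : ℝ × ℝ => f p.2 := hf.comp measurable_snd
    exact (h1.mul h2).mul (((by fun_prop : Measurable fun p : ℝ × ℝ =>
      ENNReal.ofReal (p.1 ^ k / k !) * ENNReal.ofReal (Real.exp (-(c * p.2))))).mul h3)
  have hl : ∫⁻ t in Set.Ici 0, ENNReal.ofReal (t ^ k / k ! * Real.exp (-(c * t))) *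
      ∫⁻ s, f (t + s) ∂erlang c 0 = ∫⁻ t, ∫⁻ r, F t r := by
    rw [← lintegral_indicator measurableSet_Ici]
    refine lintegral_congr fun t => ?_
    by_cases ht : t ∈ Set.Ici (0 : ℝ)
    · have hft : Measurable fun s => f (t + s) := hf.comp (measurable_const_add t)
      rw [Set.indicator_of_mem ht, lintegral_eq _ _ hft, ← lintegral_indicator measurableSet_Ici,
        ← lintegral_const_mul, ← lintegral_add_left_eq_self (fun r => F t r) t]
      · refine lintegral_congr fun s => ?_
        by_cases hs : 0 ≤ s
        · have h0 : (0 : ℝ) ≤ t ^ k / k ! := by have := Set.mem_Ici.1 ht; positivity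
          simp only [hF, Set.indicator, Set.mem_Ici, hs, if_true, Pi.one_apply, one_mul,
            le_add_iff_nonneg_right, Set.mem_Ici.1 ht, pow_zero, Nat.factorial_zero, Nat.cast_one,
            div_one]
          rw [← mul_assoc, ← ENNReal.ofReal_mul (by positivity), ← ENNReal.ofReal_mul h0]
          congr 2
          rw [mul_assoc, ← Real.exp_add]
          congr 2
          ring
        · simp [hF, hs]
      · exact (Measurable.mul (by fun_prop) hft).indicator measurableSet_Ici
    · rw [Set.indicator_of_notMem ht]
      simp [hF, ht]
  rw [hl, lintegral_lintegral_swap hFm.aemeasurable, ← lintegral_indicator measurableSet_Ici]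
  refine lintegral_congr fun r => ?_
  by_cases hr : r ∈ Set.Ici (0 : ℝ)
  · rw [Set.indicator_of_mem hr, ENNReal.ofReal_mul (by have := Set.mem_Ici.1 hr; positivity),
      ← setLIntegral_Icc_pow k hr, mul_assoc, ← lintegral_indicator measurableSet_Icc,
      ← lintegral_mul_const]
    · refine lintegral_congr fun t => ?_
      by_cases h1 : 0 ≤ t <;> by_cases h2 : t ≤ r <;> simp [hF, h1, h2, mul_assoc]
    · exact Measurable.indicator (by fun_prop) measurableSet_Icc
  · rw [Set.indicator_of_notMem hr]
    refine (lintegral_congr fun t => ?_).trans lintegral_zero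
    by_cases h1 : 0 ≤ t
    · have : ¬ t ≤ r := fun h => hr (h1.trans h)
      simp [hF, this]
    · simp [hF, h1]

theorem conv_eq : Measure.conv (erlang c k) (erlang c l) = erlang c (k + l + 1) := by
  induction l with
  | zero => exact conv_zero c k
  | succ l ih => rw [← conv_zero c l, ← Measure.conv_assoc, ih, conv_zero]; rfl

theorem one_zero_univ : erlang 1 0 Set.univ = 1 := by
  have h : ∫⁻ t in Set.Ioi (0 : ℝ), ENNReal.ofReal (Real.exp (-t)) = 1 := by
    rw [← ofReal_integral_eq_lintegral_ofReal (integrableOn_exp_neg_Ioi 0)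
      (ae_of_all _ fun t => (Real.exp_pos _).le), integral_exp_neg_Ioi_zero, ENNReal.ofReal_one]
  rw [erlang, withDensity_apply _ MeasurableSet.univ, Measure.restrict_univ,
    ← Measure.restrict_congr_set Ioi_ae_eq_Ici]
  simpa using h

theorem one_univ : erlang 1 k Set.univ = 1 := by
  induction k with
  | zero => exact one_zero_univ
  | succ k ih =>
    rw [← conv_zero, Measure.conv, Measure.map_apply measurable_add MeasurableSet.univ,
      Set.preimage_univ, ← Set.univ_prod_univ, Measure.prod_prod, ih, one_zero_univ, one_mul]

/-- Comparing t^k/k! · t^l/l! with t^(k+l)/(k+l)! produces the binomial coefficient that appears in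
`flowCount`. -/
theorem withDensity_pow : (erlang c l).withDensity (fun t => ENNReal.ofReal (t ^ k / k !)) =
    ((k + l).choose l : ℝ≥0∞) • erlang c (k + l) := by
  rw [erlang, erlang, ← withDensity_mul _ (measurable_density c l) (by fun_prop),
    ← withDensity_smul _ (measurable_density c (k + l))]
  refine withDensity_congr_ae ((ae_restrict_mem measurableSet_Ici).mono fun t ht => ?_)
  have ht0 : (0 : ℝ) ≤ t := ht
  simp only [Pi.mul_apply, Pi.smul_apply, smul_eq_mul]
  rw [← ENNReal.ofReal_natCast, ← ENNReal.ofReal_mul (by positivity),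
    ← ENNReal.ofReal_mul (by positivity)]
  congr 1
  have h : (((k + l).choose l : ℕ) : ℝ) * (l ! * k !) = (k + l)! := by
    have := Nat.add_choose_mul_factorial_mul_factorial k l
    rw [← this]; push_cast; ring
  rw [← h]
  have : (((k + l).choose l : ℕ) : ℝ) ≠ 0 := by
    exact_mod_cast (Nat.choose_pos (Nat.le_add_left l k)).ne'
  field_simp
  ring

theorem withDensity_pow_zero : (erlang c 0).withDensity (fun t => ENNReal.ofReal (t ^ k / k !)) =
    erlang c k := by
  rw [withDensity_pow, Nat.choose_zero_right, Nat.cast_one, one_smul, add_zero]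

end erlang

theorem sum_pow_div_factorial {ι : Type*} [Fintype ι] [DecidableEq ι] (x : ι → ℝ) (n : ℕ) :
    (∑ i, x i) ^ n / n ! =
      ∑ k ∈ Finset.piAntidiag Finset.univ n, ∏ i, x i ^ k i / (k i)! := by
  rw [Finset.sum_pow_eq_sum_piAntidiag, Finset.sum_div]
  refine Finset.sum_congr rfl fun k hk => ?_
  have h := Nat.multinomial_spec Finset.univ k
  rw [(Finset.mem_piAntidiag.1 hk).1] at h
  have h' : (∏ i, ((k i)! : ℝ)) * Nat.multinomial Finset.univ k = n ! := by exact_mod_cast h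
  have h0 : (∏ i, ((k i)! : ℝ)) ≠ 0 :=
    Finset.prod_ne_zero_iff.2 fun i _ => by positivity
  have hn : (n ! : ℝ) ≠ 0 := by positivity
  rw [Finset.prod_div_distrib, div_eq_div_iff hn h0, ← h']
  ring

/-! ### Flows on the complete signed graph and removal of the first vertex -/

/-- The edges of the complete signed graph of type `D_m`. -/
abbrev EdgeD (m : ℕ) : Type := {p : Fin m × Fin m // p.1 < p.2} × ℤˣ

/-- The edges at the first vertex of the complete signed graph (negative edges on the left,
positive edges on the right) and the edges of the graph on the remaining vertices. -/
def edgeDEquiv (m : ℕ) : (Fin m ⊕ Fin m) ⊕ EdgeD m ≃ EdgeD (m + 1) :=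
  Equiv.ofBijective
    (Sum.elim
      (Sum.elim (fun j => ⟨⟨(0, j.succ), j.succ_pos⟩, -1⟩)
        fun j => ⟨⟨(0, j.succ), j.succ_pos⟩, 1⟩)
      fun e => ⟨⟨(e.1.1.1.succ, e.1.1.2.succ), Fin.succ_lt_succ_iff.2 e.1.2⟩, e.2⟩) (by
    constructor
    · rintro ((i | i) | ⟨⟨⟨i, j⟩, h⟩, s⟩) ((i' | i') | ⟨⟨⟨i', j'⟩, h'⟩, s'⟩) hh <;>
        simp_all [Prod.ext_iff, Fin.ext_iff]
    · rintro ⟨⟨⟨i, j⟩, h⟩, s⟩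
      obtain ⟨j, rfl⟩ := Fin.exists_succ_eq.2 (Fin.ne_zero_of_lt h)
      refine Fin.cases (fun h => ?_) (fun i h => ?_) i h
      · rcases Int.units_eq_one_or s with rfl | rfl
        · exact ⟨.inl (.inr j), rfl⟩
        · exact ⟨.inl (.inl j), rfl⟩
      · exact ⟨.inr ⟨⟨(i, j), Fin.succ_lt_succ_iff.1 h⟩, s⟩, rfl⟩)

/-- The net outflow at the vertices of a flow on the complete signed graph. -/
def netOutflow (m : ℕ) : (EdgeD m → ℝ) →ₗ[ℝ] (Fin m → ℝ) :=
  (completeSignedGraphD m).rootMatrix.mulVecLin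

theorem netOutflow_apply {m : ℕ} (b : EdgeD m → ℝ) (i : Fin m) :
    netOutflow m b i = ∑ e : EdgeD m,
      (((Pi.single e.1.1.1 1 : Fin m → ℝ) i + ((e.2 : ℤ) : ℝ) * (Pi.single e.1.1.2 1 : Fin m → ℝ) i)
        * b e) := by
  have : ∀ e : EdgeD m, (completeSignedGraphD m).rootMatrix i e =
      (Pi.single e.1.1.1 1 : Fin m → ℝ) i + ((e.2 : ℤ) : ℝ) * (Pi.single e.1.1.2 1 : Fin m → ℝ) i := by
    intro e
    simp only [SignedGraph.rootMatrix, SignedGraph.root, completeSignedGraphD,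
      Pi.add_apply, Pi.smul_apply, smul_eq_mul, Pi.single_apply]
    push_cast
    rfl
  simp only [← this]
  rfl

/-- The flow on the complete signed graph with `m + 1` vertices that has values `c` on the edges at
the first vertex and `b` on the other edges. -/
def glueFlow {m : ℕ} (c : Fin m ⊕ Fin m → ℝ) (b : EdgeD m → ℝ) : EdgeD (m + 1) → ℝ :=
  Sum.elim c b ∘ (edgeDEquiv m).symm

theorem sum_edgeD_succ {m : ℕ} {M : Type*} [AddCommMonoid M] (f : EdgeD (m + 1) → M) :
    ∑ e, f e = (∑ j, f (edgeDEquiv m (.inl (.inl j))) + ∑ j, f (edgeDEquiv m (.inl (.inr j)))) +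
      ∑ e, f (edgeDEquiv m (.inr e)) := by
  rw [← (edgeDEquiv m).sum_comp, Fintype.sum_sum_type, Fintype.sum_sum_type]

theorem edgeDEquiv_inl_inl {m : ℕ} (j : Fin m) :
    edgeDEquiv m (.inl (.inl j)) = ⟨⟨(0, j.succ), j.succ_pos⟩, -1⟩ := rfl

theorem edgeDEquiv_inl_inr {m : ℕ} (j : Fin m) :
    edgeDEquiv m (.inl (.inr j)) = ⟨⟨(0, j.succ), j.succ_pos⟩, 1⟩ := rfl

theorem edgeDEquiv_inr {m : ℕ} (e : EdgeD m) :
    edgeDEquiv m (.inr e) =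
      ⟨⟨(e.1.1.1.succ, e.1.1.2.succ), Fin.succ_lt_succ_iff.2 e.1.2⟩, e.2⟩ := rfl

theorem glueFlow_edgeDEquiv {m : ℕ} (c : Fin m ⊕ Fin m → ℝ) (b : EdgeD m → ℝ)
    (x : (Fin m ⊕ Fin m) ⊕ EdgeD m) : glueFlow c b (edgeDEquiv m x) = Sum.elim c b x := by
  simp [glueFlow]

theorem netOutflow_glueFlow_zero {m : ℕ} (c : Fin m ⊕ Fin m → ℝ) (b : EdgeD m → ℝ) :
    netOutflow (m + 1) (glueFlow c b) 0 = ∑ i, c i := by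
  rw [netOutflow_apply, sum_edgeD_succ]
  simp only [glueFlow_edgeDEquiv, Sum.elim_inl, Sum.elim_inr]
  simp only [edgeDEquiv_inl_inl, edgeDEquiv_inl_inr, edgeDEquiv_inr, Pi.single_apply,
    (Fin.succ_ne_zero _).symm, if_true, if_false]
  simp

theorem netOutflow_glueFlow_succ {m : ℕ} (c : Fin m ⊕ Fin m → ℝ) (b : EdgeD m → ℝ) (i : Fin m) :
    netOutflow (m + 1) (glueFlow c b) i.succ = c (.inr i) - c (.inl i) + netOutflow m b i := by
  rw [netOutflow_apply, netOutflow_apply, sum_edgeD_succ]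
  simp only [glueFlow_edgeDEquiv, Sum.elim_inl, Sum.elim_inr]
  simp only [edgeDEquiv_inl_inl, edgeDEquiv_inl_inr, edgeDEquiv_inr, Pi.single_apply,
    Fin.succ_ne_zero, if_false, Fin.succ_inj]
  simp [sub_eq_neg_add]

/-- The exponential rates at negative and positive edges. -/
def signRate {m : ℕ} : Fin m ⊕ Fin m → ℝ := Sum.elim (fun _ => 0) fun _ => 1

/-- The measure with density `exp (-∑ b_e)`, where the sum is over the positive edges `e`,
on the nonnegative flows of the complete signed graph. -/
def flowMeasure (m : ℕ) : Measure (EdgeD m → ℝ) :=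
  Measure.pi fun e => erlang (if e.2 = 1 then 1 else 0) 0

instance (m : ℕ) : SigmaFinite (flowMeasure m) :=
  inferInstanceAs (SigmaFinite (Measure.pi _))

theorem lintegral_flowMeasure_succ {m : ℕ} {f : (EdgeD (m + 1) → ℝ) → ℝ≥0∞} (hf : Measurable f) :
    ∫⁻ b, f b ∂flowMeasure (m + 1) =
      ∫⁻ c, ∫⁻ b, f (glueFlow c b) ∂flowMeasure m
        ∂(Measure.pi fun i : Fin m ⊕ Fin m => erlang (signRate i) 0) := by
  have h : (fun i : Fin m ⊕ Fin m => erlang (signRate i) 0) =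
      fun i => erlang (if (edgeDEquiv m (.inl i)).2 = 1 then 1 else 0) 0 := by
    funext i
    rcases i with i | i
    · rw [edgeDEquiv_inl_inl, if_neg (show ¬(-1 : ℤˣ) = 1 by decide)]; rfl
    · rw [edgeDEquiv_inl_inr, if_pos rfl]; rfl
  have hm : Measurable fun x : (Fin m ⊕ Fin m) ⊕ EdgeD m → ℝ => f (x ∘ (edgeDEquiv m).symm) :=
    hf.comp (measurable_pi_iff.2 fun i => measurable_pi_apply _)
  rw [flowMeasure, lintegral_pi_equiv (edgeDEquiv m), lintegral_pi_sum _ hm, h]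
  rfl

/-- The exponentially weighted volume of the nonnegative flows on the complete signed graph whose
net outflow at each vertex is at least the difference of two given vectors. -/
def flowVolume (m : ℕ) (y : Fin m ⊕ Fin m → ℝ) : ℝ≥0∞ :=
  flowMeasure m {b | ∀ i, y (.inl i) ≤ y (.inr i) + netOutflow m b i}

theorem measurable_netOutflow (m : ℕ) : Measurable (netOutflow m) :=
  (LinearMap.continuous_of_finiteDimensional _).measurable

theorem measurableSet_flow (m : ℕ) : MeasurableSet {p : (Fin m ⊕ Fin m → ℝ) × (EdgeD m → ℝ) |
    ∀ i, p.1 (.inl i) ≤ p.1 (.inr i) + netOutflow m p.2 i} := by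
  rw [Set.ofPred_forall]
  refine MeasurableSet.iInter fun i => measurableSet_le ?_ (Measurable.add ?_ ?_)
  · exact (measurable_pi_apply _).comp measurable_fst
  · exact (measurable_pi_apply _).comp measurable_fst
  · exact (measurable_pi_apply i).comp ((measurable_netOutflow m).comp measurable_snd)

theorem measurable_flowVolume (m : ℕ) : Measurable (flowVolume m) :=
  measurable_measure_prodMk_left (measurableSet_flow m)

/-- The inequality at the first vertex involves only the edges there. Their flows `c` then enter the
inequalities at the other vertices, on the left for negative edges and on the right for positive
ones. -/
theorem flowVolume_succ {m : ℕ} (y : Fin (m + 1) ⊕ Fin (m + 1) → ℝ) :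
    flowVolume (m + 1) y =
      ∫⁻ c, {c : Fin m ⊕ Fin m → ℝ | y (.inl 0) ≤ y (.inr 0) + ∑ i, c i}.indicator
          (fun c => flowVolume m fun i => y (i.map Fin.succ Fin.succ) + c i) c
        ∂(Measure.pi fun i : Fin m ⊕ Fin m => erlang (signRate i) 0) := by
  have hS : MeasurableSet {b | ∀ i, y (.inl i) ≤ y (.inr i) + netOutflow (m + 1) b i} :=
    measurable_prodMk_left (x := y) (measurableSet_flow (m + 1))
  rw [flowVolume, ← lintegral_indicator_one hS,
    lintegral_flowMeasure_succ (measurable_one.indicator hS)]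
  refine lintegral_congr fun c => ?_
  have hS' : MeasurableSet {b | ∀ i : Fin m, y (.inl i.succ) + c (.inl i) ≤
      y (.inr i.succ) + c (.inr i) + netOutflow m b i} :=
    measurable_prodMk_left (x := fun i : Fin m ⊕ Fin m => y (i.map Fin.succ Fin.succ) + c i)
      (measurableSet_flow m)
  by_cases hc : y (.inl 0) ≤ y (.inr 0) + ∑ i, c i
  · rw [Set.indicator_of_mem (by exact hc), flowVolume]
    simp only [Sum.map_inl, Sum.map_inr]
    rw [← lintegral_indicator_one hS']
    refine lintegral_congr fun b => ?_
    have : (glueFlow c b ∈ {b | ∀ i, y (.inl i) ≤ y (.inr i) + netOutflow (m + 1) b i}) ↔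
        b ∈ {b | ∀ i : Fin m, y (.inl i.succ) + c (.inl i) ≤
          y (.inr i.succ) + c (.inr i) + netOutflow m b i} := by
      simp only [Set.mem_ofPred_eq, Fin.forall_fin_succ, netOutflow_glueFlow_zero,
        netOutflow_glueFlow_succ, hc, true_and]
      refine forall_congr' fun i => ?_
      constructor <;> intro h <;> linarith
    simp only [Set.indicator_apply, this]
    rfl
  · rw [Set.indicator_of_notMem (by exact hc)]
    refine (lintegral_congr fun b => ?_).trans lintegral_zero
    refine Set.indicator_of_notMem (fun h => hc ?_) _
    simpa only [netOutflow_glueFlow_zero] using h 0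

/-- Adds a first entry to each of two vectors. -/
def consSum {m : ℕ} (t s : ℝ) (y : Fin m ⊕ Fin m → ℝ) : Fin (m + 1) ⊕ Fin (m + 1) → ℝ :=
  Sum.elim (Fin.cons t fun i => y (.inl i)) (Fin.cons s fun i => y (.inr i))

/-- The first entries of two vectors, and the others. -/
def optionSumEquiv (m : ℕ) : Option (Option (Fin m ⊕ Fin m)) ≃ Fin (m + 1) ⊕ Fin (m + 1) :=
  Equiv.ofBijective
    (fun o => o.elim (.inl 0) fun o => o.elim (.inr 0) fun i => i.map Fin.succ Fin.succ) (by
    constructor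
    · rintro (_ | _ | i | i) (_ | _ | j | j) h <;> simp_all [Fin.ext_iff]
    · rintro (i | i) <;> refine Fin.cases ?_ (fun i => ?_) i
      · exact ⟨none, rfl⟩
      · exact ⟨some (some (.inl i)), rfl⟩
      · exact ⟨some none, rfl⟩
      · exact ⟨some (some (.inr i)), rfl⟩)

theorem consSum_eq {m : ℕ} (t s : ℝ) (y : Fin m ⊕ Fin m → ℝ) :
    (fun o : Option (Option (Fin m ⊕ Fin m)) => o.elim t fun o => o.elim s y) ∘
      (optionSumEquiv m).symm = consSum t s y := by
  funext j
  obtain ⟨o, rfl⟩ := (optionSumEquiv m).surjective j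
  rw [Function.comp_apply, Equiv.symm_apply_apply]
  rcases o with _ | _ | i | i <;> rfl

theorem lintegral_pi_finSum_succ {m : ℕ} (μ : Fin (m + 1) ⊕ Fin (m + 1) → Measure ℝ)
    [∀ i, SigmaFinite (μ i)] {f : (Fin (m + 1) ⊕ Fin (m + 1) → ℝ) → ℝ≥0∞} (hf : Measurable f) :
    ∫⁻ y, f y ∂Measure.pi μ = ∫⁻ t, ∫⁻ s, ∫⁻ y, f (consSum t s y)
      ∂(Measure.pi fun i : Fin m ⊕ Fin m => μ (i.map Fin.succ Fin.succ)) ∂μ (.inr 0)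
        ∂μ (.inl 0) := by
  have hm : Measurable fun x : Option (Option (Fin m ⊕ Fin m)) → ℝ =>
      f (x ∘ (optionSumEquiv m).symm) :=
    hf.comp (measurable_pi_iff.2 fun i => measurable_pi_apply _)
  rw [lintegral_pi_equiv (optionSumEquiv m), lintegral_pi_option _ hm]
  refine lintegral_congr fun t => ?_
  rw [lintegral_pi_option]
  · simp only [consSum_eq]
    rfl
  · exact hm.comp ((measurePreserving_pi_option fun i => μ (optionSumEquiv m i)).measurable.comp
      measurable_prodMk_left)

/-! ### The recursion for the weighted volume of flows -/

theorem erlang.lintegral_pow (k l : ℕ) :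
    ∫⁻ s, ENNReal.ofReal (s ^ k / k !) ∂erlang 1 l = (k + l).choose l := by
  have h := congrArg (fun μ : Measure ℝ => μ Set.univ) (erlang.withDensity_pow 1 k l)
  simp only [withDensity_apply _ MeasurableSet.univ, Measure.restrict_univ, Measure.smul_apply,
    erlang.one_univ, smul_eq_mul, mul_one] at h
  exact h

/-- In each coordinate the power changes the index 0 of the density of `w` to `k i`; adding `y` then
convolves it with the measure of index `κ i`. -/
theorem erlang.lintegral_pi_pow {ι : Type*} [Fintype ι] (c : ι → ℝ) (κ k : ι → ℕ)
    {f : (ι → ℝ) → ℝ≥0∞} (hf : Measurable f) :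
    ∫⁻ y, ∫⁻ w, (∏ i, ENNReal.ofReal (w i ^ k i / (k i)!)) * f (y + w)
        ∂(Measure.pi fun i => erlang (c i) 0) ∂(Measure.pi fun i => erlang (c i) (κ i)) =
      ∫⁻ y, f y ∂Measure.pi fun i => erlang (c i) (κ i + k i + 1) := by
  have hs : ∀ i, SigmaFinite ((erlang (c i) 0).withDensity
      fun t => ENNReal.ofReal (t ^ k i / (k i)!)) := fun i => by
    rw [erlang.withDensity_pow_zero]; infer_instance
  have hs' : ∀ i, SigmaFinite (Measure.conv (erlang (c i) (κ i)) (erlang (c i) (k i))) := fun i => by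
    rw [erlang.conv_eq]; infer_instance
  simp only [← erlang.conv_eq]
  rw [← lintegral_pi_add _ _ hf]
  refine lintegral_congr fun y => ?_
  refine (lintegral_pi_prod_mul (fun i => erlang (c i) 0)
    (g := fun i t => ENNReal.ofReal (t ^ k i / (k i)!)) (fun i => by fun_prop)
    (hf.comp (measurable_const_add y))).trans ?_
  simp only [erlang.withDensity_pow_zero, Function.comp_apply]

theorem erlang.pi_ae_nonneg {ι : Type*} [Fintype ι] (c : ι → ℝ) (κ : ι → ℕ) :
    ∀ᵐ w ∂(Measure.pi fun i => erlang (c i) (κ i)), ∀ i, 0 ≤ w i :=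
  ae_all_iff.2 fun i =>
    (Measure.tendsto_eval_ae_ae (μ := fun i => erlang (c i) (κ i)) (i := i)).eventually
      (erlang.ae_nonneg _ _)

theorem erlang.zero_apply_Iic_add_sum {ι : Type*} [Fintype ι] [DecidableEq ι] (a : ℕ) {s : ℝ}
    {w : ι → ℝ} (hs : 0 ≤ s) (hw : ∀ i, 0 ≤ w i) :
    erlang 0 a (Set.Iic (s + ∑ i, w i)) =
      ∑ k ∈ Finset.piAntidiag (Finset.univ : Finset (Option ι)) (a + 1),
        ENNReal.ofReal (s ^ k none / (k none)!) *
          ∏ i, ENNReal.ofReal (w i ^ k (some i) / (k (some i))!) := by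
  have h := sum_pow_div_factorial (fun o : Option ι => o.elim s w) (a + 1)
  simp only [Fintype.sum_option, Fintype.prod_option, Option.elim_none, Option.elim_some] at h
  rw [erlang.zero_apply_Iic _ (add_nonneg hs (Finset.sum_nonneg fun i _ => hw i)), h,
    ENNReal.ofReal_sum_of_nonneg]
  · refine Finset.sum_congr rfl fun k _ => ?_
    rw [ENNReal.ofReal_mul (by positivity), ENNReal.ofReal_prod_of_nonneg]
    intro i _
    have := hw i
    positivity
  · intro k _
    exact mul_nonneg (by positivity) (Finset.prod_nonneg fun i _ => by have := hw i; positivity)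

/-- Each step of the induction integrates out the two entries at the first vertex and matches the
result with the recursion of `flowCount`. -/
theorem lintegral_flowVolume {m : ℕ} (κ : Fin m ⊕ Fin m → ℕ) :
    ∫⁻ y, flowVolume m y ∂(Measure.pi fun i => erlang (signRate i) (κ i)) = flowCount m κ := by
  induction m with
  | zero =>
    have : ∀ y, flowVolume 0 y = 1 := fun y => by
      simp [flowVolume, flowMeasure]
    simp [this, flowCount]
  | succ m ih =>
    rw [lintegral_pi_finSum_succ _ (measurable_flowVolume _)]
    simp only [flowVolume_succ]
    set ρ := Measure.pi fun i : Fin m ⊕ Fin m => erlang (signRate i) 0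
    set σ := Measure.pi fun i : Fin m ⊕ Fin m =>
      erlang (signRate (i.map Fin.succ Fin.succ)) (κ (i.map Fin.succ Fin.succ)) with hσ
    have hσ' : σ = Measure.pi fun i : Fin m ⊕ Fin m =>
        erlang (signRate i) (κ (i.map Fin.succ Fin.succ)) := by
      rw [hσ]; congr 1; funext i; cases i <;> rfl
    have hΦ : Measurable fun p : ℝ × (Fin m ⊕ Fin m → ℝ) × (Fin m ⊕ Fin m → ℝ) =>
        flowVolume m (p.2.1 + p.2.2) := (measurable_flowVolume m).comp (by fun_prop)
    -- The argument is (t, s, y, w): the two entries at the first vertex, the entries at the other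
    -- vertices, and the flows on the edges at the first vertex.
    set F : ℝ × ℝ × (Fin m ⊕ Fin m → ℝ) × (Fin m ⊕ Fin m → ℝ) → ℝ≥0∞ :=
      {q | q.1 ≤ q.2.1 + ∑ i, q.2.2.2 i}.indicator
        (fun q => flowVolume m (q.2.2.1 + q.2.2.2)) with hF
    have hFm : Measurable F :=
      ((measurable_flowVolume m).comp (by fun_prop)).indicator
        (measurableSet_le (by fun_prop) (by fun_prop))
    have hGm : ∀ k : Option (Fin m ⊕ Fin m) → ℕ,
        Measurable fun p : ℝ × (Fin m ⊕ Fin m → ℝ) × (Fin m ⊕ Fin m → ℝ) =>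
          ENNReal.ofReal (p.1 ^ k none / (k none)!) *
            ((∏ i, ENNReal.ofReal (p.2.2 i ^ k (some i) / (k (some i))!)) *
              flowVolume m (p.2.1 + p.2.2)) := fun k =>
      Measurable.mul (by fun_prop) (Measurable.mul (by fun_prop) hΦ)
    have hpos : ∀ᵐ p ∂((erlang 1 (κ (.inr 0))).prod (σ.prod ρ)), 0 ≤ p.1 ∧ ∀ i, 0 ≤ p.2.2 i :=
      (Measure.quasiMeasurePreserving_fst.ae (erlang.ae_nonneg 1 _)).and
        (Measure.quasiMeasurePreserving_snd.ae
          (Measure.quasiMeasurePreserving_snd.ae (erlang.pi_ae_nonneg signRate fun _ => 0)))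
    calc _ = ∫⁻ t, ∫⁻ p, F (t, p) ∂((erlang 1 (κ (.inr 0))).prod (σ.prod ρ))
            ∂erlang 0 (κ (.inl 0)) := by
          refine lintegral_congr fun t => ?_
          have h1 := hFm.comp (measurable_prodMk_left (x := t))
          refine ((lintegral_prod _ h1.aemeasurable).trans (lintegral_congr fun s => ?_)).symm
          exact lintegral_prod _ (h1.comp (measurable_prodMk_left (x := s))).aemeasurable
      -- Integrating over t innermost leaves the measure of the half line t ≤ s + ∑ w_i, a power of
      -- s + ∑ w_i since t has rate 0.
      _ = ∫⁻ p, ∫⁻ t, F (t, p) ∂erlang 0 (κ (.inl 0))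
            ∂((erlang 1 (κ (.inr 0))).prod (σ.prod ρ)) :=
          lintegral_lintegral_swap hFm.aemeasurable
      _ = ∫⁻ p, erlang 0 (κ (.inl 0)) (Set.Iic (p.1 + ∑ i, p.2.2 i)) *
            flowVolume m (p.2.1 + p.2.2) ∂((erlang 1 (κ (.inr 0))).prod (σ.prod ρ)) := by
          refine lintegral_congr fun p => ?_
          rw [mul_comm, ← lintegral_indicator_const measurableSet_Iic]
          rfl
      _ = ∫⁻ p, ∑ k ∈ Finset.piAntidiag (Finset.univ : Finset (Option (Fin m ⊕ Fin m)))
              (κ (.inl 0) + 1), ENNReal.ofReal (p.1 ^ k none / (k none)!) *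
                ((∏ i, ENNReal.ofReal (p.2.2 i ^ k (some i) / (k (some i))!)) *
                  flowVolume m (p.2.1 + p.2.2))
              ∂((erlang 1 (κ (.inr 0))).prod (σ.prod ρ)) := by
          refine lintegral_congr_ae (hpos.mono fun p hp => ?_)
          simp only [erlang.zero_apply_Iic_add_sum _ hp.1 hp.2, Finset.sum_mul, mul_assoc]
      _ = flowCount (m + 1) κ := by
        rw [lintegral_finsetSum _ fun k _ => hGm k, flowCount, Nat.cast_sum]
        refine Finset.sum_congr rfl fun k _ => ?_
        have h2 := Measurable.mul (f := fun p : (Fin m ⊕ Fin m → ℝ) × (Fin m ⊕ Fin m → ℝ) =>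
            ∏ i, ENNReal.ofReal (p.2 i ^ k (some i) / (k (some i))!)) (by fun_prop)
          ((measurable_flowVolume m).comp measurable_add)
        refine (lintegral_prod_mul (f := fun s => ENNReal.ofReal (s ^ k none / (k none)!))
          (by fun_prop) h2.aemeasurable).trans ?_
        rw [erlang.lintegral_pow, Nat.cast_mul, add_comm (k none), ← ih]
        congr 1
        refine (lintegral_prod _ h2.aemeasurable).trans ?_
        rw [hσ']
        exact erlang.lintegral_pi_pow signRate _ (fun i => k (some i)) (measurable_flowVolume m)

theorem lintegral_pi_fin_tail {m : ℕ} (μ : Measure ℝ) [IsProbabilityMeasure μ]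
    {f : (Fin m → ℝ) → ℝ≥0∞} (hf : Measurable f) :
    ∫⁻ u, f (fun i => u i.succ) ∂(Measure.pi fun _ : Fin (m + 1) => μ) =
      ∫⁻ u, f u ∂(Measure.pi fun _ => μ) := by
  have h := measurePreserving_piFinSuccAbove (fun _ : Fin (m + 1) => μ) 0
  have h2 := h.lintegral_comp (hf.comp measurable_snd)
  rw [lintegral_prod _ (hf.comp measurable_snd).aemeasurable] at h2
  simpa [Fin.tail_def] using h2

/-- The exponentially weighted volume of the flows without negative edges at the first vertex. -/
theorem lintegral_flowVolume_zero (m : ℕ) :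
    ∫⁻ u, flowVolume (m + 1) (Sum.elim 0 u) ∂(Measure.pi fun _ => erlang 1 0) =
      flowCount m (Sum.elim 0 1) := by
  have hprob : IsProbabilityMeasure (erlang 1 0) := ⟨erlang.one_zero_univ⟩
  have hE : (fun i : Fin m ⊕ Fin m => erlang (signRate i) ((Sum.elim 0 1 : _ → ℕ) i)) =
      Sum.elim (fun _ => erlang 0 0) fun _ => erlang 1 1 := by
    funext i; cases i <;> rfl
  have hE0 : (fun i : Fin m ⊕ Fin m => erlang (signRate i) 0) =
      Sum.elim (fun _ => erlang 0 0) fun _ => erlang 1 0 := by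
    funext i; cases i <;> rfl
  have hs : ∀ i, SigmaFinite ((Sum.elim (fun _ => erlang 0 0) fun _ => erlang 1 1 :
      Fin m ⊕ Fin m → Measure ℝ) i) := by rintro (i | i) <;> simp only [Sum.elim_inl, Sum.elim_inr] <;> infer_instance
  have hs0 : ∀ i, SigmaFinite ((Sum.elim (fun _ => erlang 0 0) fun _ => erlang 1 0 :
      Fin m ⊕ Fin m → Measure ℝ) i) := by rintro (i | i) <;> simp only [Sum.elim_inl, Sum.elim_inr] <;> infer_instance
  have hs1 : SigmaFinite (Measure.conv (erlang 1 0) (erlang 1 0)) := by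
    rw [erlang.conv_eq]; infer_instance
  have helim : Measurable fun p : (Fin m → ℝ) × (Fin m → ℝ) =>
      (Sum.elim p.1 p.2 : Fin m ⊕ Fin m → ℝ) := by
    refine measurable_pi_iff.2 ?_
    rintro (i | i) <;> simp only [Sum.elim_inl, Sum.elim_inr] <;> fun_prop
  have hΦ : Measurable fun p : (Fin m → ℝ) × (Fin m → ℝ) × (Fin m → ℝ) =>
      flowVolume m (Sum.elim p.2.1 (p.1 + p.2.2)) :=
    (measurable_flowVolume m).comp (helim.comp (by fun_prop :
      Measurable fun p : (Fin m → ℝ) × (Fin m → ℝ) × (Fin m → ℝ) => (p.2.1, p.1 + p.2.2)))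
  have hH : Measurable fun u : Fin m → ℝ => ∫⁻ w, ∫⁻ v, flowVolume m (Sum.elim w (u + v))
      ∂(Measure.pi fun _ => erlang 1 0) ∂(Measure.pi fun _ => erlang 0 0) :=
    Measurable.lintegral_prod_right' (f := fun p : (Fin m → ℝ) × (Fin m → ℝ) =>
      ∫⁻ v, flowVolume m (Sum.elim p.2 (p.1 + v)) ∂(Measure.pi fun _ => erlang 1 0))
      (Measurable.lintegral_prod_right' (f := fun q : ((Fin m → ℝ) × (Fin m → ℝ)) × (Fin m → ℝ) =>
        flowVolume m (Sum.elim q.1.2 (q.1.1 + q.2)))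
        (hΦ.comp (by fun_prop : Measurable fun q : ((Fin m → ℝ) × (Fin m → ℝ)) × (Fin m → ℝ) =>
          (q.1.1, q.1.2, q.2))))
  rw [← lintegral_flowVolume, hE, lintegral_pi_sum _ (measurable_flowVolume m)]
  calc _ = ∫⁻ u : Fin (m + 1) → ℝ, ∫⁻ w, ∫⁻ v,
          flowVolume m (Sum.elim w ((fun i => u i.succ) + v)) ∂(Measure.pi fun _ => erlang 1 0)
          ∂(Measure.pi fun _ => erlang 0 0) ∂(Measure.pi fun _ => erlang 1 0) := by
        refine lintegral_congr_ae ((erlang.pi_ae_nonneg (fun _ => 1) fun _ => 0).mono fun u hu => ?_)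
        have hm : Measurable fun c : Fin m ⊕ Fin m → ℝ => flowVolume m
            (Sum.elim (fun i => c (.inl i)) ((fun i => u i.succ) + fun i => c (.inr i))) :=
          (measurable_flowVolume m).comp (helim.comp (by fun_prop :
            Measurable fun c : Fin m ⊕ Fin m → ℝ =>
              (fun i => c (.inl i), (fun i => u i.succ) + fun i => c (.inr i))))
        have h2 := lintegral_pi_sum (Sum.elim (fun _ => erlang 0 0) fun _ => erlang 1 0) hm
        simp only [Sum.elim_inl, Sum.elim_inr] at h2
        refine Eq.trans ?_ h2
        dsimp only
        rw [flowVolume_succ, ← hE0]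
        refine lintegral_congr_ae ((erlang.pi_ae_nonneg signRate fun _ => 0).mono fun c hc => ?_)
        dsimp only
        -- With left entry 0, the inequality at the first of these vertices holds for all
        -- nonnegative data.
        rw [Set.indicator_of_mem]
        · congr 1
          funext i
          cases i <;> simp
        · exact add_nonneg (hu 0) (Finset.sum_nonneg fun i _ => hc i)
    -- The entry `u 0` no longer occurs, and its law has total mass 1.
    _ = ∫⁻ u, ∫⁻ w, ∫⁻ v, flowVolume m (Sum.elim w (u + v)) ∂(Measure.pi fun _ => erlang 1 0)
          ∂(Measure.pi fun _ => erlang 0 0) ∂(Measure.pi fun _ => erlang 1 0) :=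
        lintegral_pi_fin_tail _ hH
    _ = ∫⁻ w, ∫⁻ u, ∫⁻ v, flowVolume m (Sum.elim w (u + v)) ∂(Measure.pi fun _ => erlang 1 0)
          ∂(Measure.pi fun _ => erlang 1 0) ∂(Measure.pi fun _ => erlang 0 0) :=
        lintegral_lintegral_swap (Measurable.lintegral_prod_right'
          (f := fun q : ((Fin m → ℝ) × (Fin m → ℝ)) × (Fin m → ℝ) =>
            flowVolume m (Sum.elim q.1.2 (q.1.1 + q.2)))
          (hΦ.comp (by fun_prop : Measurable fun q : ((Fin m → ℝ) × (Fin m → ℝ)) × (Fin m → ℝ) =>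
            (q.1.1, q.1.2, q.2)))).aemeasurable
    _ = _ := by
        refine lintegral_congr fun w => ?_
        -- Two independent exponential inflows add up to `erlang 1 1`, the source of the index 1.
        rw [lintegral_pi_add (fun _ => erlang 1 0) (fun _ => erlang 1 0)
          (f := fun v => flowVolume m (Sum.elim w v))
          ((measurable_flowVolume m).comp (helim.comp measurable_prodMk_left))]
        simp only [erlang.conv_eq]
        rfl

/-! ### Normalized volume in lattice coordinates, and slices of cones -/

/-- The image of the standard basis is a lattice basis. Passing from the transported Lebesgue
measure to Haar measure multiplies the volume and the covolume by the same constant, which cancels.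
-/
theorem normalizedVolume_eq_of_linearEquiv {ι F : Type*} [Fintype ι] [Fintype F]
    {P : Set (ι → ℝ)} {p : ι → ℝ} (hp : p ∈ P) (T : (F → ℝ) ≃ₗ[ℝ] vectorSpan ℝ P)
    (hT : ∀ y, T y ∈ integerPoints (vectorSpan ℝ P) ↔ ∀ f, ∃ k : ℤ, y f = k) :
    normalizedVolume P =
      (Fintype.card F)! * volume.real {y : F → ℝ | p + (T y : ι → ℝ) ∈ P} := by
  classical
  let b : Module.Basis F ℝ (vectorSpan ℝ P) := (Pi.basisFun ℝ F).map T
  have hL : integerPoints (vectorSpan ℝ P) = Submodule.span ℤ (Set.range b) := by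
    ext w
    obtain ⟨y, rfl⟩ := T.surjective w
    rw [hT, Module.Basis.mem_span_iff_repr_mem ℤ b]
    simp [b, eq_comm]
  have hfin : Module.finrank ℝ (vectorSpan ℝ P) = Fintype.card F := by
    rw [← T.finrank_eq, Module.finrank_fintype_fun_eq_card]
  let Tc : (F → ℝ) ≃L[ℝ] vectorSpan ℝ P := T.toContinuousLinearEquiv
  have hmap : ∀ S : Set (vectorSpan ℝ P), Measure.map Tc volume S = volume (T ⁻¹' S) := fun S =>
    Tc.toHomeomorph.toMeasurableEquiv.map_apply S
  have hsmul := Measure.isAddLeftInvariant_eq_smul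
    (Measure.addHaar : Measure (vectorSpan ℝ P)) (Measure.map Tc volume)
  set c := Measure.addHaarScalarFactor (Measure.addHaar : Measure (vectorSpan ℝ P))
    (Measure.map Tc volume) with hc
  have hc0 : c ≠ 0 := (Measure.addHaarScalarFactor_pos_of_isAddHaarMeasure _ _).ne'
  have hreal : ∀ S : Set (vectorSpan ℝ P),
      (Measure.addHaar : Measure (vectorSpan ℝ P)).real S = c * volume.real (T ⁻¹' S) := by
    intro S
    rw [hsmul, measureReal_nnreal_smul_apply, Measure.real, hmap]; rfl
  have hdom : T ⁻¹' (ZSpan.fundamentalDomain b) = Set.pi Set.univ fun _ => Set.Ico (0 : ℝ) 1 := by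
    ext y
    simp [ZSpan.mem_fundamentalDomain, b]
  have hvol : volume.real (Set.pi Set.univ fun _ : F => Set.Ico (0 : ℝ) 1) = 1 := by
    rw [Measure.real, Real.volume_pi_Ico]; simp
  have hcov : ZLattice.covolume (integerPoints (vectorSpan ℝ P)) Measure.addHaar = c := by
    rw [hL, ZLattice.covolume_eq_measure_fundamentalDomain _ _ (ZSpan.isAddFundamentalDomain b _),
      hreal, hdom, hvol, mul_one]
  rw [normalizedVolume_eq hp, hfin, hcov, hreal, mul_div_cancel_left₀]
  · rfl
  · exact_mod_cast hc0

/-- A strictly positive point can be moved slightly along any kernel vector without leaving the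
orthant. -/
theorem vectorSpan_nonneg_fiber {ι V : Type*} [Fintype ι] [AddCommGroup V] [Module ℝ V]
    (N : (ι → ℝ) →ₗ[ℝ] V) {a : V} {p : ι → ℝ} (hp : ∀ i, 0 < p i) (hN : N p = a) :
    vectorSpan ℝ {b | (∀ i, 0 ≤ b i) ∧ N b = a} = LinearMap.ker N := by
  refine le_antisymm (Submodule.span_le.2 ?_) fun w hw => ?_
  · rintro _ ⟨x, hx, y, hy, rfl⟩
    simp [hx.2, hy.2]
  · have h : ∀ᶠ ε in nhdsWithin (0 : ℝ) (Set.Ioi 0), ∀ i, 0 < p i + ε * w i := by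
      refine Filter.eventually_all.2 fun i => ?_
      have : Filter.Tendsto (fun ε : ℝ => p i + ε * w i) (nhdsWithin 0 (Set.Ioi 0))
          (nhds (p i + 0 * w i)) :=
        (Continuous.tendsto (by fun_prop) 0).mono_left nhdsWithin_le_nhds
      exact this.eventually (lt_mem_nhds (by simpa using hp i))
    obtain ⟨ε, hε, hε0⟩ := (h.and self_mem_nhdsWithin).exists
    have hmem : p + ε • w ∈ {b | (∀ i, 0 ≤ b i) ∧ N b = a} :=
      ⟨fun i => (hε i).le, by simp [LinearMap.mem_ker.1 hw, hN]⟩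
    have := vsub_mem_vectorSpan ℝ hmem (⟨fun i => (hp i).le, hN⟩ : p ∈ {b | (∀ i, 0 ≤ b i) ∧ N b = a})
    rw [vsub_eq_sub, add_sub_cancel_left] at this
    exact (Submodule.smul_mem_iff _ (ne_of_gt hε0)).1 this

/-- The linear form has coefficient 1 at `none`, so taking it as a coordinate r is a
volume-preserving shear. The slice at height r is r times the slice at height 1, and ∫ r^d exp(-r)
dr = d!. -/
theorem lintegral_exp_neg_cone {F : Type*} [Fintype F] {C : Set (Option F → ℝ)}
    (hC : MeasurableSet C) (hsmul : ∀ r : ℝ, 0 < r → ∀ x ∈ C, r • x ∈ C) (s : F → ℝ)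
    (hs : ∀ x ∈ C, 0 ≤ x none + ∑ i, s i * x (some i)) :
    ∫⁻ x, C.indicator (fun x => ENNReal.ofReal
        (Real.exp (-(x none + ∑ i, s i * x (some i))))) x =
      (Fintype.card F)! * volume {y : F → ℝ |
        (fun o : Option F => o.elim (1 - ∑ i, s i * y i) y) ∈ C} := by
  have hopt : Measurable fun p : ℝ × (F → ℝ) => fun o : Option F => o.elim p.1 p.2 :=
    (measurePreserving_pi_option fun _ => volume).measurable
  have hm : Measurable (C.indicator fun x => ENNReal.ofReal
      (Real.exp (-(x none + ∑ i, s i * x (some i))))) :=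
    Measurable.indicator (by fun_prop) hC
  have hshift : Measurable fun p : ℝ × (F → ℝ) =>
      fun o : Option F => o.elim (p.1 - ∑ i, s i * p.2 i) p.2 :=
    hopt.comp (by fun_prop : Measurable fun p : ℝ × (F → ℝ) => (p.1 - ∑ i, s i * p.2 i, p.2))
  set S : ℝ → Set (F → ℝ) := fun r =>
    {y | (fun o : Option F => o.elim (r - ∑ i, s i * y i) y) ∈ C} with hS
  have hSm : ∀ r, MeasurableSet (S r) := fun r => hC.preimage (hshift.comp measurable_prodMk_left)
  have hscale : ∀ r : ℝ, 0 < r → S r = r • S 1 := by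
    intro r hr
    ext y
    rw [Set.mem_smul_set_iff_inv_smul_mem₀ hr.ne']
    have hy : (fun o : Option F => o.elim (1 - ∑ i, s i * (r⁻¹ • y) i) (r⁻¹ • y)) =
        r⁻¹ • fun o : Option F => o.elim (r - ∑ i, s i * y i) y := by
      funext o
      cases o with
      | none =>
        simp only [Option.elim_none, Pi.smul_apply, smul_eq_mul, mul_sub, inv_mul_cancel₀ hr.ne',
          Finset.mul_sum]
        congr 1
        exact Finset.sum_congr rfl fun i _ => by ring
      | some i => rfl
    simp only [hS, Set.mem_ofPred_eq, hy]
    refine ⟨hsmul _ (inv_pos.2 hr) _, fun h => ?_⟩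
    have := hsmul r hr _ h
    rwa [smul_inv_smul₀ hr.ne'] at this
  have hneg : ∀ r : ℝ, r < 0 → S r = ∅ := by
    intro r hr
    refine Set.eq_empty_of_forall_notMem fun y hy => ?_
    have := hs _ hy
    simp only [Option.elim_none, Option.elim_some] at this
    linarith
  have hvol : ∀ r : ℝ, 0 < r →
      volume (S r) = ENNReal.ofReal (r ^ Fintype.card F) * volume (S 1) := by
    intro r hr
    rw [hscale r hr, Measure.addHaar_smul, Module.finrank_fintype_fun_eq_card,
      abs_of_pos (by positivity)]
  calc _ = ∫⁻ t, ∫⁻ y, C.indicator (fun x => ENNReal.ofReal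
          (Real.exp (-(x none + ∑ i, s i * x (some i))))) fun o => o.elim t y := by
        exact lintegral_pi_option (fun _ => volume) hm
    _ = ∫⁻ y, ∫⁻ t, C.indicator (fun x => ENNReal.ofReal
          (Real.exp (-(x none + ∑ i, s i * x (some i))))) fun o => o.elim t y :=
        lintegral_lintegral_swap (hm.comp hopt).aemeasurable
    _ = ∫⁻ y, ∫⁻ r, (S r).indicator (fun _ => ENNReal.ofReal (Real.exp (-r))) y := by
        refine lintegral_congr fun y => ?_
        rw [← lintegral_sub_right_eq_self _ (∑ i, s i * y i)]
        refine lintegral_congr fun r => ?_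
        classical
        simp only [Set.indicator_apply, Option.elim_none, Option.elim_some, sub_add_cancel]
        rfl
    _ = ∫⁻ r, ∫⁻ y, (S r).indicator (fun _ => ENNReal.ofReal (Real.exp (-r))) y := by
        refine lintegral_lintegral_swap ?_
        refine Measurable.aemeasurable ?_
        have : Measurable ({p : (F → ℝ) × ℝ | p.1 ∈ S p.2}.indicator
            fun p => ENNReal.ofReal (Real.exp (-p.2))) :=
          Measurable.indicator (by fun_prop) (hC.preimage (hshift.comp measurable_swap))
        exact this
    _ = ∫⁻ r, ENNReal.ofReal (Real.exp (-r)) * volume (S r) := by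
        refine lintegral_congr fun r => ?_
        rw [lintegral_indicator_const (hSm r)]
    _ = ∫⁻ r in Set.Ici 0, ENNReal.ofReal (Real.exp (-r)) * volume (S r) := by
        refine (setLIntegral_eq_of_support_subset fun r hr => ?_).symm
        by_contra h
        exact hr (by simp [hneg r (not_le.1 h)])
    -- The scaling law is available only for r > 0; the point 0 is null.
    _ = ∫⁻ r in Set.Ioi 0, ENNReal.ofReal (Real.exp (-r)) * volume (S r) := by
        rw [restrict_Ioi_eq_restrict_Ici]
    _ = ∫⁻ r in Set.Ioi 0, ENNReal.ofReal
          (r ^ Fintype.card F / (Fintype.card F)! * Real.exp (-(1 * r))) *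
            ((Fintype.card F)! * volume (S 1)) := by
        refine setLIntegral_congr_fun measurableSet_Ioi fun r hr => ?_
        have hr0 : (0 : ℝ) < r := hr
        rw [hvol r hr, ← mul_assoc, ← mul_assoc, ← ENNReal.ofReal_mul (by positivity),
          ← ENNReal.ofReal_natCast, ← ENNReal.ofReal_mul (by positivity)]
        congr 2
        field_simp
    _ = _ := by
        rw [lintegral_mul_const _ (by fun_prop), restrict_Ioi_eq_restrict_Ici,
          ← Measure.restrict_univ (μ := volume.restrict _), ← withDensity_apply _ MeasurableSet.univ]
        refine (congrArg (· * _) (erlang.one_univ (Fintype.card F))).trans (one_mul _)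

/-- A positive edge contributes 1 + 1 and a negative edge 1 - 1, so total netflow 2 means total
positive flow 1. -/
theorem sum_netOutflow {m : ℕ} (b : EdgeD m → ℝ) :
    ∑ i, netOutflow m b i = 2 * ∑ e : EdgeD m, (if e.2 = 1 then 1 else 0) * b e := by
  simp only [netOutflow_apply]
  rw [Finset.sum_comm, Finset.mul_sum]
  refine Finset.sum_congr rfl fun e _ => ?_
  rw [← Finset.sum_mul, Finset.sum_add_distrib, ← Finset.mul_sum]
  simp only [Finset.sum_pi_single', Finset.mem_univ, if_true, ← mul_assoc]
  congr 1
  rcases Int.units_eq_one_or e.2 with h | h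
  · rw [h]; norm_num
  · rw [h, if_neg (show ¬(-1 : ℤˣ) = 1 by decide)]; norm_num

/-- For a constant flow the positive and negative edges arriving from an earlier vertex cancel,
leaving only outgoing edges. -/
theorem netOutflow_const_nonneg {m : ℕ} {t : ℝ} (ht : 0 ≤ t) (i : Fin m) :
    0 ≤ netOutflow m (fun _ => t) i := by
  induction m with
  | zero => exact i.elim0
  | succ m ih =>
    have h : (fun _ => t : EdgeD (m + 1) → ℝ) = glueFlow (fun _ => t) fun _ => t := by
      funext e
      obtain ⟨x, rfl⟩ := (edgeDEquiv m).surjective e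
      rw [glueFlow_edgeDEquiv]
      cases x <;> rfl
    rw [h]
    refine Fin.cases ?_ (fun i => ?_) i
    · rw [netOutflow_glueFlow_zero]
      exact Finset.sum_nonneg fun _ _ => ht
    · rw [netOutflow_glueFlow_succ, sub_self, zero_add]
      exact ih i

/-! ### Coordinates on the cone of flows -/

/-- The edges of the complete signed graph other than the negative edges at the first vertex. -/
abbrev ReducedEdgeD (m : ℕ) : Type := Fin m ⊕ EdgeD m

/-- The flow with net outflow zero at all vertices but the first which has given values on all edges
other than the negative edges at the first vertex. -/
def completedFlow (m : ℕ) : (ReducedEdgeD m → ℝ) →ₗ[ℝ] (EdgeD (m + 1) → ℝ) where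
  toFun x := glueFlow (Sum.elim
    (fun j => x (.inl j) + netOutflow m (fun e => x (.inr e)) j) fun j => x (.inl j))
    fun e => x (.inr e)
  map_add' x y := by
    have h : (fun e => (x + y) (.inr e) : EdgeD m → ℝ) =
      (fun e => x (.inr e)) + fun e => y (.inr e) := rfl
    funext e
    obtain ⟨a, rfl⟩ := (edgeDEquiv m).surjective e
    rw [Pi.add_apply, glueFlow_edgeDEquiv, glueFlow_edgeDEquiv, glueFlow_edgeDEquiv, h, map_add]
    rcases a with (a | a) | a <;> simp only [Sum.elim_inl, Sum.elim_inr, Pi.add_apply]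
    ring
  map_smul' c x := by
    have h : (fun e => (c • x) (.inr e) : EdgeD m → ℝ) = c • fun e => x (.inr e) := rfl
    funext e
    obtain ⟨a, rfl⟩ := (edgeDEquiv m).surjective e
    rw [Pi.smul_apply, glueFlow_edgeDEquiv, glueFlow_edgeDEquiv, h, map_smul]
    rcases a with (a | a) | a <;>
      simp only [Sum.elim_inl, Sum.elim_inr, Pi.smul_apply, smul_eq_mul, RingHom.id_apply]
    ring

/-- `1` at positive edges and `0` at negative edges. -/
def posRate {m : ℕ} : ReducedEdgeD m → ℝ :=
  Sum.elim (fun _ => 1) fun e => if e.2 = 1 then 1 else 0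

theorem posRate_mem_int {m : ℕ} (a : ReducedEdgeD m) : ∃ k : ℤ, posRate a = k := by
  rcases a with a | a
  · exact ⟨1, by simp [posRate]⟩
  · exact ⟨if a.2 = 1 then 1 else 0, by simp [posRate]⟩

section

variable {m : ℕ} (x : ReducedEdgeD m → ℝ)

theorem completedFlow_inl_inl (j : Fin m) : completedFlow m x (edgeDEquiv m (.inl (.inl j))) =
    x (.inl j) + netOutflow m (fun e => x (.inr e)) j :=
  glueFlow_edgeDEquiv _ _ _

theorem completedFlow_inl_inr (j : Fin m) :
    completedFlow m x (edgeDEquiv m (.inl (.inr j))) = x (.inl j) :=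
  glueFlow_edgeDEquiv _ _ _

theorem completedFlow_inr (e : EdgeD m) :
    completedFlow m x (edgeDEquiv m (.inr e)) = x (.inr e) :=
  glueFlow_edgeDEquiv _ _ _

theorem netOutflow_completedFlow : netOutflow (m + 1) (completedFlow m x) =
    Fin.cons (2 * ∑ a, posRate a * x a) 0 := by
  funext v
  refine Fin.cases ?_ (fun i => ?_) v
  · refine (netOutflow_glueFlow_zero _ _).trans ?_
    rw [Fin.cons_zero, Fintype.sum_sum_type, Fintype.sum_sum_type]
    simp only [Sum.elim_inl, Sum.elim_inr, Finset.sum_add_distrib, sum_netOutflow, posRate, one_mul]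
    ring
  · refine (netOutflow_glueFlow_succ _ _ i).trans ?_
    simp

theorem completedFlow_injective : Function.Injective (completedFlow m) := by
  intro x y h
  funext a
  rcases a with a | a
  · rw [← completedFlow_inl_inr x, h, completedFlow_inl_inr]
  · rw [← completedFlow_inr x, h, completedFlow_inr]

theorem exists_completedFlow_eq {b : EdgeD (m + 1) → ℝ}
    (hb : ∀ i : Fin m, netOutflow (m + 1) b i.succ = 0) : ∃ x, completedFlow m x = b := by
  have h : b = glueFlow (fun a => b (edgeDEquiv m (.inl a))) fun e => b (edgeDEquiv m (.inr e)) := by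
    funext e
    obtain ⟨a, rfl⟩ := (edgeDEquiv m).surjective e
    rw [glueFlow_edgeDEquiv]
    cases a <;> rfl
  refine ⟨Sum.elim (fun j => b (edgeDEquiv m (.inl (.inr j)))) fun e => b (edgeDEquiv m (.inr e)), ?_⟩
  funext e
  obtain ⟨a, rfl⟩ := (edgeDEquiv m).surjective e
  rcases a with (j | j) | a
  · have := hb j
    rw [h, netOutflow_glueFlow_succ] at this
    rw [completedFlow_inl_inl]
    simp only [Sum.elim_inl, Sum.elim_inr]
    linarith
  · rw [completedFlow_inl_inr]; rfl
  · rw [completedFlow_inr]; rfl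

theorem completedFlow_nonneg_iff : (∀ e, 0 ≤ completedFlow m x e) ↔
    (∀ a, 0 ≤ x a) ∧ ∀ i, 0 ≤ x (.inl i) + netOutflow m (fun e => x (.inr e)) i := by
  rw [← (edgeDEquiv m).forall_congr_right]
  simp only [Sum.forall, completedFlow_inl_inl, completedFlow_inl_inr, completedFlow_inr]
  tauto

theorem netOutflow_mem_int {b : EdgeD m → ℝ} (hb : ∀ e, ∃ k : ℤ, b e = k) (i : Fin m) :
    ∃ k : ℤ, netOutflow m b i = k := by
  choose k hk using hb
  refine ⟨∑ e : EdgeD m, ((Pi.single e.1.1.1 1 : Fin m → ℤ) i +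
    (e.2 : ℤ) * (Pi.single e.1.1.2 1 : Fin m → ℤ) i) * k e, ?_⟩
  rw [netOutflow_apply]
  push_cast
  refine Finset.sum_congr rfl fun e _ => ?_
  simp only [hk, Pi.single_apply]
  push_cast
  rfl

/-- The eliminated edges have coefficient -1 in their equations, so solving for them requires no
division. -/
theorem completedFlow_mem_int_iff :
    (∀ e, ∃ k : ℤ, completedFlow m x e = k) ↔ ∀ a, ∃ k : ℤ, x a = k := by
  rw [← (edgeDEquiv m).forall_congr_right]
  simp only [Sum.forall, completedFlow_inl_inl, completedFlow_inl_inr, completedFlow_inr]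
  refine ⟨fun h => ⟨h.1.2, h.2⟩, fun h => ⟨⟨fun j => ?_, h.1⟩, h.2⟩⟩
  obtain ⟨k, hk⟩ := h.1 j
  obtain ⟨l, hl⟩ := netOutflow_mem_int h.2 j
  exact ⟨k + l, by rw [hk, hl, Int.cast_add]⟩

end

theorem erlang_zero_eq_withDensity (c : ℝ) : erlang c 0 = volume.withDensity
    ((Set.Ici 0).indicator fun t => ENNReal.ofReal (Real.exp (-(c * t)))) := by
  rw [erlang, withDensity_indicator measurableSet_Ici]
  simp

/-- The exponential integral over the cone of nonnegative flows. -/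
theorem lintegral_completedFlow_nonneg (m : ℕ) :
    ∫⁻ x : ReducedEdgeD (m + 1) → ℝ, {x | ∀ e, 0 ≤ completedFlow (m + 1) x e}.indicator
        (fun x => ENNReal.ofReal (Real.exp (-∑ a, posRate a * x a))) x =
      flowCount m (Sum.elim 0 1) := by
  set D : Set (ReducedEdgeD (m + 1) → ℝ) :=
    {x | ∀ i, 0 ≤ x (.inl i) + netOutflow (m + 1) (fun e => x (.inr e)) i} with hD
  have hDm : MeasurableSet D := by
    rw [hD, Set.ofPred_forall]
    refine MeasurableSet.iInter fun i => measurableSet_le measurable_const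
      (Measurable.add (by fun_prop) ?_)
    exact (measurable_pi_apply i).comp ((measurable_netOutflow _).comp (by fun_prop))
  have hg : ∀ a : ReducedEdgeD (m + 1), Measurable
      ((Set.Ici 0).indicator fun t => ENNReal.ofReal (Real.exp (-(posRate a * t)))) := fun a =>
    Measurable.indicator (by fun_prop) measurableSet_Ici
  have hσ : ∀ a : ReducedEdgeD (m + 1), SigmaFinite (volume.withDensity
      ((Set.Ici 0).indicator fun t => ENNReal.ofReal (Real.exp (-(posRate a * t))))) := fun a => by
    rw [← erlang_zero_eq_withDensity]; infer_instance
  have h1 : ∫⁻ x, D.indicator (1 : (ReducedEdgeD (m + 1) → ℝ) → ℝ≥0∞) x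
      ∂(Measure.pi fun a : ReducedEdgeD (m + 1) => erlang (posRate a) 0) =
      flowCount m (Sum.elim 0 1) := by
    rw [lintegral_pi_sum _ (measurable_one.indicator hDm), ← lintegral_flowVolume_zero]
    refine lintegral_congr fun u => ?_
    have hm : MeasurableSet {b | ∀ i, (Sum.elim 0 u : Fin (m + 1) ⊕ Fin (m + 1) → ℝ) (.inl i) ≤
        (Sum.elim 0 u : Fin (m + 1) ⊕ Fin (m + 1) → ℝ) (.inr i) + netOutflow (m + 1) b i} :=
      measurable_prodMk_left (x := (Sum.elim 0 u : Fin (m + 1) ⊕ Fin (m + 1) → ℝ))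
        (measurableSet_flow (m + 1))
    rw [flowVolume, ← lintegral_indicator_one hm]
    rfl
  rw [← h1]
  simp only [erlang_zero_eq_withDensity]
  rw [← lintegral_pi_prod_mul (fun _ => volume) hg (measurable_one.indicator hDm)]
  refine lintegral_congr fun x => ?_
  classical
  by_cases hx : ∀ a, 0 ≤ x a
  · have h2 : ∀ a, (Set.Ici (0 : ℝ)).indicator
        (fun t => ENNReal.ofReal (Real.exp (-(posRate a * t)))) (x a) =
        ENNReal.ofReal (Real.exp (-(posRate a * x a))) := fun a =>
      Set.indicator_of_mem (hx a) _
    simp only [h2, Set.indicator_apply, Set.mem_ofPred_eq, completedFlow_nonneg_iff, hD]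
    rw [← ENNReal.ofReal_prod_of_nonneg (fun a _ => (Real.exp_pos _).le), ← Real.exp_sum,
      Finset.sum_neg_distrib]
    simp only [Pi.one_apply, mul_ite, mul_one, mul_zero]
    by_cases h : ∀ i, 0 ≤ x (.inl i) + netOutflow (m + 1) (fun e => x (.inr e)) i
    · rw [if_pos ⟨hx, h⟩, if_pos h]
    · rw [if_neg fun h' => h h'.2, if_neg h]
  · rw [Set.indicator_of_notMem]
    · obtain ⟨a, ha⟩ := not_forall.1 hx
      rw [Finset.prod_eq_zero (Finset.mem_univ a), zero_mul]
      exact Set.indicator_of_notMem ha _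
    · simp only [Set.mem_ofPred_eq, completedFlow_nonneg_iff]
      exact fun h => hx h.1

/-- The first positive edge at the first vertex, and the other edges. -/
def optionReducedEdgeDEquiv (m : ℕ) :
    Option (Fin m ⊕ EdgeD (m + 1)) ≃ ReducedEdgeD (m + 1) :=
  Equiv.ofBijective (fun o => o.elim (.inl 0) fun a => a.map Fin.succ id) (by
    constructor
    · rintro (_ | i | i) (_ | j | j) h <;> simp_all [Fin.ext_iff]
    · rintro (i | e)
      · refine Fin.cases ⟨none, rfl⟩ (fun i => ⟨some (.inl i), rfl⟩) i
      · exact ⟨some (.inr e), rfl⟩)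

section

variable (m : ℕ)

/-- The values on the edges but the first positive edge `e`, extended by a value on `e` for which
the values on the positive edges sum to `t`. -/
def extendedFlow (t : ℝ) (y : Fin m ⊕ EdgeD (m + 1) → ℝ) : ReducedEdgeD (m + 1) → ℝ :=
  (fun o : Option (Fin m ⊕ EdgeD (m + 1)) =>
    o.elim (t - ∑ a, posRate (optionReducedEdgeDEquiv m (some a)) * y a) y) ∘
      (optionReducedEdgeDEquiv m).symm

variable {m}

theorem extendedFlow_none (t : ℝ) (y : Fin m ⊕ EdgeD (m + 1) → ℝ) :
    extendedFlow m t y (optionReducedEdgeDEquiv m none) =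
      t - ∑ a, posRate (optionReducedEdgeDEquiv m (some a)) * y a := by
  simp [extendedFlow]

theorem extendedFlow_some (t : ℝ) (y : Fin m ⊕ EdgeD (m + 1) → ℝ) (a : Fin m ⊕ EdgeD (m + 1)) :
    extendedFlow m t y (optionReducedEdgeDEquiv m (some a)) = y a := by
  simp [extendedFlow]

theorem funext_option {f g : ReducedEdgeD (m + 1) → ℝ}
    (h : ∀ o, f (optionReducedEdgeDEquiv m o) = g (optionReducedEdgeDEquiv m o)) : f = g :=
  funext ((optionReducedEdgeDEquiv m).forall_congr_right.1 h)

theorem posRate_none : posRate (optionReducedEdgeDEquiv m none) = 1 := rfl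

theorem sum_posRate_eq (x : ReducedEdgeD (m + 1) → ℝ) :
    ∑ a, posRate a * x a = x (optionReducedEdgeDEquiv m none) +
      ∑ a, posRate (optionReducedEdgeDEquiv m (some a)) * x (optionReducedEdgeDEquiv m (some a)) := by
  rw [← (optionReducedEdgeDEquiv m).sum_comp, Fintype.sum_option, posRate_none, one_mul]

theorem sum_posRate_extendedFlow (t : ℝ) (y : Fin m ⊕ EdgeD (m + 1) → ℝ) :
    ∑ a, posRate a * extendedFlow m t y a = t := by
  rw [sum_posRate_eq]
  simp only [extendedFlow_none, extendedFlow_some]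
  ring

variable (m) in
/-- `extendedFlow` as a linear map, for flows with positive part of sum zero. -/
def extendedFlowHom : (Fin m ⊕ EdgeD (m + 1) → ℝ) →ₗ[ℝ] (ReducedEdgeD (m + 1) → ℝ) where
  toFun := extendedFlow m 0
  map_add' x y := by
    refine funext_option fun o => ?_
    cases o with
    | none =>
      simp only [Pi.add_apply, extendedFlow_none, mul_add, Finset.sum_add_distrib]
      ring
    | some a => simp only [Pi.add_apply, extendedFlow_some]
  map_smul' c x := by
    refine funext_option fun o => ?_
    cases o with
    | none =>
      simp only [Pi.smul_apply, extendedFlow_none, smul_eq_mul, RingHom.id_apply, zero_sub, mul_neg,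
        Finset.mul_sum]
      congr 1
      exact Finset.sum_congr rfl fun _ _ => by ring
    | some a => simp only [Pi.smul_apply, extendedFlow_some, RingHom.id_apply]

theorem extendedFlow_one_zero_add (y : Fin m ⊕ EdgeD (m + 1) → ℝ) :
    extendedFlow m 1 0 + extendedFlowHom m y = extendedFlow m 1 y := by
  refine funext_option fun o => ?_
  change extendedFlow m 1 0 _ + extendedFlow m 0 y _ = _
  cases o with
  | none => simp [extendedFlow_none, sub_eq_add_neg]
  | some a => simp [extendedFlow_some]

/-- The cone formula applies with the total positive flow as linear form; the first positive edge
plays the role of `none`. -/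
theorem volume_extendedFlow :
    (Fintype.card (Fin m ⊕ EdgeD (m + 1)))! * volume {y : Fin m ⊕ EdgeD (m + 1) → ℝ |
      ∀ e, 0 ≤ completedFlow (m + 1) (extendedFlow m 1 y) e} =
      (flowCount m (Sum.elim 0 1) : ℝ≥0∞) := by
  rw [← lintegral_completedFlow_nonneg]
  have hre : Measurable fun x : Option (Fin m ⊕ EdgeD (m + 1)) → ℝ =>
      x ∘ (optionReducedEdgeDEquiv m).symm :=
    measurable_pi_iff.2 fun i => measurable_pi_apply _
  have hcf : Measurable (completedFlow (m + 1)) :=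
    (LinearMap.continuous_of_finiteDimensional _).measurable
  have hC : MeasurableSet {x : Option (Fin m ⊕ EdgeD (m + 1)) → ℝ |
      ∀ e, 0 ≤ completedFlow (m + 1) (x ∘ (optionReducedEdgeDEquiv m).symm) e} := by
    rw [Set.ofPred_forall]
    exact MeasurableSet.iInter fun e => measurableSet_le measurable_const
      ((measurable_pi_apply e).comp (hcf.comp hre))
  have key := lintegral_exp_neg_cone hC ?_
    (fun a => posRate (optionReducedEdgeDEquiv m (some a))) ?_
  · refine key.symm.trans ?_
    refine Eq.trans ?_ (lintegral_pi_equiv (optionReducedEdgeDEquiv m) (fun _ => volume) _).symm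
    refine lintegral_congr fun x => ?_
    classical
    simp only [Set.indicator_apply, sum_posRate_eq, Function.comp_apply, Equiv.symm_apply_apply,
      Set.mem_ofPred_eq]
  · intro r hr x hx e
    have h : (r • x) ∘ (optionReducedEdgeDEquiv m).symm =
      r • (x ∘ (optionReducedEdgeDEquiv m).symm) := rfl
    rw [h, map_smul]
    exact mul_nonneg hr.le (hx e)
  · intro x hx
    have h := ((completedFlow_nonneg_iff _).1 hx).1
    have h' : ∀ o, 0 ≤ x o := fun o => by simpa using h (optionReducedEdgeDEquiv m o)
    refine add_nonneg (h' _) (Finset.sum_nonneg fun a _ => mul_nonneg ?_ (h' _))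
    unfold posRate
    rcases optionReducedEdgeDEquiv m (some a) with a | a
    · exact zero_le_one
    · simp only [Sum.elim_inr]; split_ifs <;> norm_num

end

/-! ### The volume of the polytope -/

theorem CRYD_eq (m : ℕ) : (CRYD (m + 2) : Set (EdgeD (m + 2) → ℝ)) =
    {b | (∀ e, 0 ≤ b e) ∧ netOutflow (m + 2) b = Fin.cons 2 0} := by
  have h : (fun v : Fin (m + 2) => (((if v.val = 0 then 2 else 0 : ℤ)) : ℝ)) = Fin.cons 2 0 := by
    funext v
    refine Fin.cases ?_ (fun i => ?_) v <;> simp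
  rw [← h]
  rfl

theorem exists_pos_flow (m : ℕ) :
    ∃ b : EdgeD (m + 2) → ℝ, (∀ e, 0 < b e) ∧ netOutflow (m + 2) b = Fin.cons 2 0 := by
  -- The number of positive edges: giving every reduced edge the flow K⁻¹ makes the total positive
  -- flow 1.
  set K : ℝ := ∑ a : ReducedEdgeD (m + 1), posRate a with hK
  have hK0 : 0 < K := by
    rw [hK, Fintype.sum_sum_type]
    simp only [posRate, Sum.elim_inl, Sum.elim_inr]
    refine add_pos_of_pos_of_nonneg (by simp; positivity) (Finset.sum_nonneg fun e _ => ?_)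
    split_ifs <;> norm_num
  refine ⟨completedFlow (m + 1) fun _ => K⁻¹, ?_, ?_⟩
  · have hpos : 0 < K⁻¹ := inv_pos.2 hK0
    rw [← (edgeDEquiv (m + 1)).forall_congr_right]
    simp only [Sum.forall, completedFlow_inl_inl, completedFlow_inl_inr, completedFlow_inr]
    exact ⟨⟨fun j => add_pos_of_pos_of_nonneg hpos (netOutflow_const_nonneg hpos.le j),
      fun _ => hpos⟩, fun _ => hpos⟩
  · rw [netOutflow_completedFlow, ← Finset.sum_mul, ← hK, mul_inv_cancel₀ hK0.ne', mul_one]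

theorem normalizedVolume_CRYD (m : ℕ) :
    normalizedVolume (CRYD (m + 2)) = flowCount m (Sum.elim 0 1) := by
  set P : Set (EdgeD (m + 2) → ℝ) := {b | (∀ e, 0 ≤ b e) ∧ netOutflow (m + 2) b = Fin.cons 2 0}
    with hP
  have hspan : vectorSpan ℝ P = LinearMap.ker (netOutflow (m + 2)) := by
    obtain ⟨b, hb, hb'⟩ := exists_pos_flow m
    exact vectorSpan_nonneg_fiber (netOutflow (m + 2)) hb hb'
  let T₀ : (Fin m ⊕ EdgeD (m + 1) → ℝ) →ₗ[ℝ] (EdgeD (m + 2) → ℝ) :=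
    completedFlow (m + 1) ∘ₗ extendedFlowHom m
  have hmem : ∀ y, T₀ y ∈ vectorSpan ℝ P := fun y => by
    rw [hspan, LinearMap.mem_ker]
    refine (netOutflow_completedFlow _).trans ?_
    rw [show ∑ a, posRate a * extendedFlowHom m y a = 0 from sum_posRate_extendedFlow 0 y]
    funext v
    refine Fin.cases ?_ (fun i => ?_) v <;> simp
  have hbij : Function.Bijective (T₀.codRestrict (vectorSpan ℝ P) hmem) := by
    constructor
    · intro y z h
      have h1 := completedFlow_injective (congrArg Subtype.val h)
      funext a
      have h2 := congrFun h1 (optionReducedEdgeDEquiv m (some a))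
      exact (extendedFlow_some 0 y a).symm.trans (h2.trans (extendedFlow_some 0 z a))
    · rintro ⟨w, hw⟩
      have hw' := hw
      rw [hspan, LinearMap.mem_ker] at hw'
      obtain ⟨x, rfl⟩ := exists_completedFlow_eq fun i => congrFun hw' i.succ
      have h0 : 2 * ∑ a, posRate a * x a = 0 := by
        have := congrFun hw' 0
        rwa [netOutflow_completedFlow] at this
      rw [sum_posRate_eq] at h0
      refine ⟨fun a => x (optionReducedEdgeDEquiv m (some a)), Subtype.ext ?_⟩
      refine congrArg (completedFlow (m + 1)) (funext_option fun o => ?_)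
      cases o with
      | none =>
        refine (extendedFlow_none _ _).trans ?_
        linarith
      | some a => exact extendedFlow_some _ _ _
  let T : (Fin m ⊕ EdgeD (m + 1) → ℝ) ≃ₗ[ℝ] vectorSpan ℝ P := LinearEquiv.ofBijective _ hbij
  -- The base point has flow 1 on both edges between the first two vertices and 0 elsewhere.
  have hp : completedFlow (m + 1) (extendedFlow m 1 0) ∈ P := by
    refine ⟨(completedFlow_nonneg_iff _).2 ?_, ?_⟩
    · have h0 : ∀ a, 0 ≤ extendedFlow m 1 0 a :=
        (optionReducedEdgeDEquiv m).forall_congr_right.1 fun o => by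
          cases o with
          | none => simp [extendedFlow_none]
          | some a => simp [extendedFlow_some]
      have h1 : (fun e => extendedFlow m 1 0 (.inr e) : EdgeD (m + 1) → ℝ) = 0 :=
        funext fun e => extendedFlow_some 1 0 (.inr e)
      refine ⟨h0, fun i => ?_⟩
      rw [h1, map_zero]
      simpa using h0 (.inl i)
    · rw [netOutflow_completedFlow, sum_posRate_extendedFlow, mul_one]
  have hT : ∀ y, T y ∈ integerPoints (vectorSpan ℝ P) ↔ ∀ a, ∃ k : ℤ, y a = k := by
    intro y
    refine (completedFlow_mem_int_iff (extendedFlow m 0 y)).trans ?_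
    rw [← (optionReducedEdgeDEquiv m).forall_congr_right, Option.forall]
    simp only [extendedFlow_none, extendedFlow_some]
    -- The value on the first positive edge is an integer combination of the others, so it imposes
    -- no further integrality condition.
    refine and_iff_right_of_imp fun h => ?_
    choose k hk using h
    choose l hl using posRate_mem_int (m := m + 1)
    refine ⟨-∑ a, l (optionReducedEdgeDEquiv m (some a)) * k a, ?_⟩
    push_cast
    simp only [hk, hl, zero_sub]
  have hset : {y | completedFlow (m + 1) (extendedFlow m 1 0) + (T y : EdgeD (m + 2) → ℝ) ∈ P} =
      {y | ∀ e, 0 ≤ completedFlow (m + 1) (extendedFlow m 1 y) e} := by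
    ext y
    have h : completedFlow (m + 1) (extendedFlow m 1 0) + (T y : EdgeD (m + 2) → ℝ) =
        completedFlow (m + 1) (extendedFlow m 1 y) := by
      rw [← extendedFlow_one_zero_add y, map_add]; rfl
    simp only [hP, Set.mem_ofPred_eq, h, netOutflow_completedFlow, sum_posRate_extendedFlow,
      mul_one, and_true]
  change normalizedVolume (ι := EdgeD (m + 2)) (CRYD (m + 2)) = _
  rw [CRYD_eq, ← hP, normalizedVolume_eq_of_linearEquiv hp T hT, hset, Measure.real,
    ← ENNReal.toReal_natCast, ← ENNReal.toReal_mul, volume_extendedFlow, ENNReal.toReal_natCast]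

end

theorem proposition7p4 (n : ℕ) (hn : 2 ≤ n) :
    normalizedVolume (CRYD n) =
      (iteratedConstantTerm (n - 2) (morrisLikeFunction (iterLaurentX (n - 2))) : ℝ) := by
  obtain ⟨m, rfl⟩ := Nat.exists_eq_add_of_le' hn
  rw [normalizedVolume_CRYD, Nat.add_sub_cancel, iteratedConstantTerm_morrisLikeFunction,
    Rat.cast_natCast]
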